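/- For a Tychonoff space $X$ let $P(X)$ be the space of Radon probability measures on $X$ (Borel probability measures that are inner regular with respect to compact sets) with the weak topology. Let $P_\tau(X)$ (resp. $P_\sigma(X)$) be the subspace of all $\mu\in P(\beta X)$ such that $\mu(K)=0$ for every compact $K\subset\beta X\setminus X$ (resp. for every compact $K\subset\beta X\setminus X$ that is a $G_\delta$-set in $\beta X$). A space is pseudocompact if every continuous real-valued function on it is bounded. A Mrówka space is a Tychonoff space $X$ whose isolated points form a countable dense set, whose non-isolated points form a discrete subspace, and for which $|\beta X\setminus X|=1$. For a family $\mathcal M=\{M_\alpha:\alpha\in A\}$ of subsets of a set $D$ disjoint from $A$, $\Psi(D,\mathcal M)$ is the set $D\cup A$ with the topology generated by the sets $\{u\}$ and $\Psi(D,\mathcal M)\setminus\{u\}$ ($u\in D$) and $\{\alpha\}\cup M_\alpha$ ($\alpha\in A$). Let $2^{<\omega}=\bigcup_n 2^n$ be the Cantor tree of finite binary sequences. **Theorem.** There exist a family $\{D_x:x\in 2^{\omega}\}$ of infinite subsets of $2^{<\omega}$ and a partition $\mathcal P$ of $2^\omega$ into two-point sets such that - $\{x\restriction n:n\in\omega\}\subset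 D_x$ for every $x\in 2^\omega$; the family $\{D_x\}$ is maximal almost disjoint ($D_x\cap D_y$ is finite for $x\ne y$, and every infinite subset of $2^{<\omega}$ has infinite intersection with some $D_x$); and $|D_x\cap 2^n|\le 2$ for all $x\in 2^\omega$ and $n\in\omega$; and such that for $E_P=\bigcup_{x\in P}D_x$ ($P\in\mathcal P$) the $\Psi$-space $X=\Psi(2^{<\omega},\{E_P:P\in\mathcal P\})$ has the following properties: 1. $X$ is a Mrówka space; 2. $X$ is locally compact, and every power $X^I$ is pseudocompact; 3. $P(X)$ is not pseudocompact; 4. (Bogachev's question: does $\beta P(X)=P(\beta X)$ hold for locally compact pseudocompact $X$?) $P(X)$ is not $C^*$-embedded in $P(\beta X)$, i.e. some bounded continuous real function on $P(X)$ does not extend continuously to $P(\beta X)$; moreover the canonical map $P(X)\to P(\beta X)$ does not extend to a homeomorphism of $\beta P(X)$ onto $P(\beta X)$; 5. (Banakh–Chigogidze–Fedorchuk, Problem 5.5: is $P_\sigma(X)$ the Hewitt realcompactification of $P_\tau(X)$?) $P_\tau(X)$ is not $C$-embedded in $P_\sigma(X)$, i.e. some continuous real function on $P_\tau(X)$ does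 not extend continuously to $P_\sigma(X)$; in particular $P_\sigma(X)$, with the inclusion $P_\tau(X)\subset P_\sigma(X)$, is not the Hewitt realcompactification of $P_\tau(X)$. -/

import Mathlib

open Set MeasureTheory Topology

universe u

noncomputable section

/-! ### Pseudocompactness, C-embeddings, realcompactness -/

/-- Every continuous real-valued function is bounded. -/
def IsPseudocompact (X : Type*) [TopologicalSpace X] : Prop :=
  ∀ f : X → ℝ, Continuous f → ∃ C : ℝ, ∀ x, |f x| ≤ C

/-- Every continuous real function on `Y` extends along `e : Y → Z` to a continuous function. -/
def IsCEmbedded {Y Z : Type*} [TopologicalSpace Y] [TopologicalSpace Z] (e : Y → Z) : Prop :=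
  ∀ f : Y → ℝ, Continuous f → ∃ g : Z → ℝ, Continuous g ∧ ∀ y, g (e y) = f y

/-- Every bounded continuous real function on `Y` extends along `e : Y → Z` to a continuous
function. -/
def IsCStarEmbedded {Y Z : Type*} [TopologicalSpace Y] [TopologicalSpace Z] (e : Y → Z) : Prop :=
  ∀ f : Y → ℝ, Continuous f → (∃ C : ℝ, ∀ y, |f y| ≤ C) →
    ∃ g : Z → ℝ, Continuous g ∧ ∀ y, g (e y) = f y

/-- `Z` embeds as a closed subspace into a product of real lines. -/
def IsRealcompact (Z : Type u) [TopologicalSpace Z] : Prop :=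
  ∃ (A : Type u) (e : Z → (A → ℝ)), IsClosedEmbedding e

/-- `e : Y → Z` exhibits `Z` as the Hewitt realcompactification of `Y`. -/
def IsHewittRealcompactification {Y Z : Type*} [TopologicalSpace Y] [TopologicalSpace Z]
    (e : Y → Z) : Prop :=
  IsEmbedding e ∧ DenseRange e ∧ IsCEmbedded e ∧ IsRealcompact Z

/-! ### Spaces of Radon probability measures -/

/-- `P(X)`: the Radon probability measures on the Borel σ-algebra of `X` (the measure of each Borel
set is approximated from inside by compact sets), with the weak topology, i.e. the subspace
topology inherited from `ProbabilityMeasure X`. -/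
abbrev RadonProb (X : Type*) [TopologicalSpace X] [MeasurableSpace X] [BorelSpace X] : Type _ :=
  {μ : ProbabilityMeasure X // (μ : Measure X).InnerRegular}

instance stoneCechMeasurableSpace (X : Type*) [TopologicalSpace X] :
    MeasurableSpace (StoneCech X) := borel _

instance stoneCechBorelSpace (X : Type*) [TopologicalSpace X] : BorelSpace (StoneCech X) := ⟨rfl⟩

section
variable (X : Type*) [TopologicalSpace X] [MeasurableSpace X] [BorelSpace X]

/-- The canonical map `P(X) → P(βX)`: push-forward along `X → βX`. -/
def radonToStoneCech (μ : RadonProb X) : RadonProb (StoneCech X) :=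
  ⟨μ.1.map (continuous_stoneCechUnit.measurable.aemeasurable), by
    have := μ.2
    exact Measure.InnerRegular.map_of_continuous continuous_stoneCechUnit⟩

/-- `βP(X) = P(βX)`: the canonical map `P(X) → P(βX)` extends to a homeomorphism of `βP(X)` onto
`P(βX)`. -/
def StoneCechCommutesWithRadonProb : Prop :=
  ∃ h : StoneCech (RadonProb X) ≃ₜ RadonProb (StoneCech X),
    ∀ μ : RadonProb X, h (stoneCechUnit μ) = radonToStoneCech X μ

end

section
variable (X : Type*) [TopologicalSpace X]

/-- `P_τ(X)`: the measures in `P(βX)` vanishing on all compact subsets of `βX \ X`. -/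
def RadonProbTau : Set (RadonProb (StoneCech X)) :=
  {μ | ∀ K : Set (StoneCech X), IsCompact K → K ⊆ (range (stoneCechUnit : X → StoneCech X))ᶜ →
    (μ.1 : Measure (StoneCech X)) K = 0}

/-- `P_σ(X)`: the measures in `P(βX)` vanishing on all compact subsets of `βX \ X` that are `G_δ`
in `βX`. -/
def RadonProbSigma : Set (RadonProb (StoneCech X)) :=
  {μ | ∀ K : Set (StoneCech X), IsCompact K → IsGδ K →
    K ⊆ (range (stoneCechUnit : X → StoneCech X))ᶜ → (μ.1 : Measure (StoneCech X)) K = 0}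

theorem radonProbTau_subset_sigma : RadonProbTau X ⊆ RadonProbSigma X :=
  fun _ hμ K hK _ hKX => hμ K hK hKX

/-- The inclusion of `P_τ(X)` into `P_σ(X)`. -/
def tauToSigma : RadonProbTau X → RadonProbSigma X :=
  Set.inclusion (radonProbTau_subset_sigma X)

end

/-! ### Almost disjoint families, Ψ-spaces, Mrówka spaces -/

/-- A maximal almost disjoint (indexed) family of infinite subsets of `D`. -/
structure IsMADFamily {D A : Type*} (M : A → Set D) : Prop where
  infinite : ∀ α, (M α).Infinite
  almostDisjoint : ∀ α β, α ≠ β → (M α ∩ M β).Finite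
  maximal : ∀ S : Set D, S.Infinite → ∃ α, (S ∩ M α).Infinite

/-- The underlying set `D ⊔ A` of the Mrówka–Isbell space `Ψ(D, M)` of a family
`M = (M α)_{α ∈ A}` of subsets of `D`. -/
def PsiSpace {D A : Type*} (_M : A → Set D) : Type _ := D ⊕ A

section
variable {D A : Type*} (M : A → Set D)

/-- The point of `Ψ(D, M)` given by an element of `D`. -/
def PsiSpace.ofNode (u : D) : PsiSpace M := (Sum.inl u : D ⊕ A)

/-- The point of `Ψ(D, M)` given by an index. -/
def PsiSpace.ofIndex (α : A) : PsiSpace M := (Sum.inr α : D ⊕ A)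

/-- The topology of `Ψ(D, M)`, with subbase `{u}` and `Ψ \ {u}` for `u ∈ D` and `{α} ∪ M α` for
`α ∈ A`. -/
instance PsiSpace.topologicalSpace : TopologicalSpace (PsiSpace M) :=
  TopologicalSpace.generateFrom
    ({s | ∃ u : D, s = {PsiSpace.ofNode M u}} ∪ {s | ∃ u : D, s = {PsiSpace.ofNode M u}ᶜ} ∪
      {s | ∃ α : A, s = insert (PsiSpace.ofIndex M α) (PsiSpace.ofNode M '' M α)})

instance PsiSpace.measurableSpace : MeasurableSpace (PsiSpace M) := borel _

instance PsiSpace.borelSpace : BorelSpace (PsiSpace M) := ⟨rfl⟩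

end

/-- A Mrówka space: a Tychonoff space in which the isolated points form a countable dense set and
the non-isolated points a discrete subspace, and whose Stone–Čech remainder is one point. -/
structure IsMrowkaSpace (X : Type*) [TopologicalSpace X] : Prop where
  tychonoff : T35Space X
  countable_isolated : {x : X | IsOpen ({x} : Set X)}.Countable
  dense_isolated : Dense {x : X | IsOpen ({x} : Set X)}
  discrete_nonisolated : DiscreteTopology {x : X | ¬ IsOpen ({x} : Set X)}
  remainder : (range (stoneCechUnit : X → StoneCech X))ᶜ.encard = 1

/-! ### The Cantor tree -/

/-- The Cantor tree: all finite binary sequences. -/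
abbrev CantorTree : Type := Σ n : ℕ, (Fin n → Bool)

/-- The `n`-th level of the Cantor tree: the sequences of length `n`. -/
def cantorLevel (n : ℕ) : Set CantorTree := {s | s.1 = n}

/-- The branch of an infinite binary sequence: the set of its finite initial segments. -/
def cantorBranch (x : ℕ → Bool) : Set CantorTree :=
  range fun n : ℕ => (⟨n, fun i => x i⟩ : CantorTree)

/-- `Ψ(2^{<ω}, (E_P)_{P ∈ Q})`, where `E_P` is the union of the sets `D x`, `x ∈ P`. -/
abbrev MergedPsiSpace (D : (ℕ → Bool) → Set CantorTree) (Q : Set (Set (ℕ → Bool))) : Type :=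
  PsiSpace (fun P : Q => ⋃ x ∈ P.1, D x)

end

noncomputable section

open Cardinal Filter

/-! ### A maximal almost disjoint family of thin subsets of the Cantor tree -/

/-! The family starts from the branches. Zorn's lemma gives a maximal almost disjoint collection of
infinite sets that meet each level at most once and each branch finitely. Attaching these sets
injectively to branches yields a MAD family with at most two nodes per level
(`exists_thin_madFamily`).

A continuous function on the Ψ-space has limits `g x` along the sets `D x`. As `D x` contains a
branch, `g` is a pointwise limit of functions of finitely many coordinates, hence Borel. So `{g ≤
a}` is countable or of size continuum, and maximality excludes the countably infinite case. There
are only continuum many triples `(f, a, b)`, so one pairing can place, for each triple with `{g ≤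
a}` and `{b ≤ g}` both large, a pair with one point in each (`exists_pairing`). A function
continuous after merging has equal limits on each pair, so for `a < b` one of the two sets is
finite. This forces a one-point remainder `{p}`.

Thinness governs the measures. A merged member has at most four nodes per level, so a union of `k`
basic neighbourhoods has mass at most `4k/2^n` for the uniform measure `λ_n` on level `n`. Hence
`λ_n → δ_p` in `P(βX)`. A measure in `P_τ(X)` is concentrated on `X`, so some finite union of basic
neighbourhoods has mass above 1/2, a property that persists nearby and excludes measures close to
`λ_n` for large `n`. Bumps around the `λ_n` are thus locally finite on `P_τ(X)`, and their
combinations are continuous with arbitrary values `c n` at `λ_n`. Taking `c n = n` gives an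
unbounded function; taking `c` the parity gives one with no continuous extension to `δ_p`.
Pseudocompactness of `X` puts `δ_p` in `P_σ(X)`. -/

theorem finite_cantorLevel (n : ℕ) : (cantorLevel n).Finite := by
  refine (Set.finite_range fun s : Fin n → Bool => (⟨n, s⟩ : CantorTree)).subset ?_
  rintro ⟨m, s⟩ rfl
  exact ⟨s, rfl⟩

theorem infinite_cantorBranch (x : ℕ → Bool) : (cantorBranch x).Infinite :=
  Set.infinite_range_of_injective fun _ _ h => congrArg Sigma.fst h

theorem injOn_fst_cantorBranch (x : ℕ → Bool) : InjOn Sigma.fst (cantorBranch x) := by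
  rintro _ ⟨m, rfl⟩ _ ⟨n, rfl⟩ h
  obtain rfl : m = n := h
  rfl

theorem finite_cantorBranch_inter {x y : ℕ → Bool} (h : x ≠ y) :
    (cantorBranch x ∩ cantorBranch y).Finite := by
  obtain ⟨k, hk⟩ := Function.ne_iff.1 h
  refine ((Set.finite_Iic k).biUnion fun n _ => finite_cantorLevel n).subset ?_
  rintro _ ⟨⟨n, rfl⟩, ⟨m, hm⟩⟩
  simp only [mem_iUnion, mem_Iic, cantorLevel]
  refine ⟨n, ?_, rfl⟩
  by_contra! hkn
  obtain rfl : m = n := congrArg Sigma.fst hm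
  have := congrFun (eq_of_heq (Sigma.mk.inj hm).2) ⟨k, hkn⟩
  exact hk this.symm

theorem exists_infinite_subset_injOn_fst {S : Set CantorTree} (hS : S.Infinite) :
    ∃ T ⊆ S, T.Infinite ∧ InjOn Sigma.fst T := by
  obtain ⟨T, hTS, hT⟩ := S.exists_subset_bijOn Sigma.fst
  refine ⟨T, hTS, fun hfin => hS ?_, hT.injOn⟩
  have : (Sigma.fst '' S).Finite := hT.image_eq ▸ hfin.image _
  refine (this.biUnion fun n _ => finite_cantorLevel n).subset fun s hs => ?_
  exact mem_biUnion (mem_image_of_mem _ hs) rfl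

theorem mk_set_le_continuum (α : Type) [Countable α] : #(Set α) ≤ #(ℕ → Bool) := by
  obtain ⟨f, hf⟩ := exists_injective_nat α
  classical
  refine Cardinal.mk_le_of_injective (f := fun (S : Set α) n => decide (n ∈ f '' S)) ?_
  intro S T h
  apply hf.image_injective
  ext n
  simpa using congrFun h n

theorem encard_inter_cantorLevel_le_one {T : Set CantorTree} (hT : InjOn Sigma.fst T) (n : ℕ) :
    (T ∩ cantorLevel n).encard ≤ 1 := by
  rw [Set.encard_le_one_iff]
  rintro a b ⟨ha, han⟩ ⟨hb, hbn⟩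
  exact hT ha hb (Eq.trans han (Eq.symm hbn))

theorem exists_thin_madFamily : ∃ D : (ℕ → Bool) → Set CantorTree,
    (∀ x, cantorBranch x ⊆ D x) ∧ IsMADFamily D ∧
      ∀ x n, (D x ∩ cantorLevel n).encard ≤ 2 := by
  classical
  let 𝒯 : Set (Set CantorTree) :=
    {T | T.Infinite ∧ InjOn Sigma.fst T ∧ ∀ x, (T ∩ cantorBranch x).Finite}
  obtain ⟨𝒜, h𝒜⟩ := zorn_subset
    {𝒜 : Set (Set CantorTree) | 𝒜 ⊆ 𝒯 ∧ 𝒜.Pairwise fun A B => (A ∩ B).Finite} (by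
      intro c hc hchain
      refine ⟨⋃₀ c, ⟨sUnion_subset fun A hA => (hc hA).1, ?_⟩, fun A hA => subset_sUnion_of_mem hA⟩
      exact (Set.pairwise_sUnion hchain.directedOn).2 fun A hA => (hc hA).2)
  obtain ⟨h𝒯, hpw⟩ := h𝒜.prop
  -- There are at most continuum many transversals, so each can be attached to a branch of its own;
  -- `R x` is the one attached to `x`, or empty.
  obtain ⟨g⟩ : Nonempty (𝒜 ↪ (ℕ → Bool)) :=
    Cardinal.le_def _ _ |>.1 ((Cardinal.mk_set_le 𝒜).trans (mk_set_le_continuum CantorTree))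
  let R : (ℕ → Bool) → Set CantorTree := fun x => {s | ∃ A : 𝒜, g A = x ∧ s ∈ A.1}
  have hR : ∀ x, R x = ∅ ∨ ∃ A : 𝒜, g A = x ∧ R x = A.1 := by
    intro x
    by_cases h : ∃ A, g A = x
    · obtain ⟨A, rfl⟩ := h
      refine Or.inr ⟨A, rfl, ?_⟩
      ext s
      constructor
      · rintro ⟨B, hB, hs⟩
        rwa [← g.injective hB]
      · exact fun hs => ⟨A, rfl, hs⟩
    · refine Or.inl (eq_empty_of_forall_notMem ?_)
      rintro s ⟨A, hA, -⟩
      exact h ⟨A, hA⟩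
  have hRB : ∀ x y, (R x ∩ cantorBranch y).Finite := by
    intro x y
    rcases hR x with h | ⟨A, -, h⟩
    · simp [h]
    · rw [h]; exact (h𝒯 A.2).2.2 y
  have hRR : ∀ x y, x ≠ y → (R x ∩ R y).Finite := by
    intro x y hxy
    rcases hR x with h | ⟨A, hA, h⟩
    · simp [h]
    rcases hR y with h' | ⟨B, hB, h'⟩
    · simp [h']
    rw [h, h']
    refine hpw A.2 B.2 fun hAB => hxy ?_
    rw [← hA, ← hB, Subtype.ext hAB]
  have hRinj : ∀ x, InjOn Sigma.fst (R x) := by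
    intro x
    rcases hR x with h | ⟨A, hA, h⟩
    · simp [h]
    · rw [h]; exact (h𝒯 A.2).2.1
  refine ⟨fun x => cantorBranch x ∪ R x, fun x => subset_union_left, ⟨?_, ?_, ?_⟩, ?_⟩
  · exact fun x => (infinite_cantorBranch x).mono subset_union_left
  · intro x y hxy
    refine ((((finite_cantorBranch_inter hxy).union (hRB y x)).union (hRB x y)).union
      (hRR x y hxy)).subset ?_
    rintro s ⟨h1 | h1, h2 | h2⟩ <;> simp [h1, h2]
  · intro S hS
    obtain ⟨T, hTS, hT, hTinj⟩ := exists_infinite_subset_injOn_fst hS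
    by_cases hTB : ∃ x, (T ∩ cantorBranch x).Infinite
    · obtain ⟨x, hx⟩ := hTB
      exact ⟨x, hx.mono (inter_subset_inter hTS subset_union_left)⟩
    simp only [not_exists, Set.not_infinite] at hTB
    suffices ∃ A ∈ 𝒜, (T ∩ A).Infinite by
      obtain ⟨A, hA, hTA⟩ := this
      exact ⟨g ⟨A, hA⟩, hTA.mono fun s hs => ⟨hTS hs.1, Or.inr ⟨⟨A, hA⟩, rfl, hs.2⟩⟩⟩
    by_contra! hno
    have hno : ∀ A ∈ 𝒜, (T ∩ A).Finite := fun A hA => by simpa using hno A hA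
    -- By maximality of `𝒜` such a `T` already belongs to it, and then `T ∩ T` would be finite.
    have hmem : T ∈ 𝒜 := by
      refine h𝒜.le_of_ge (y := insert T 𝒜) ⟨?_, ?_⟩ (subset_insert T 𝒜) (mem_insert T 𝒜)
      · exact insert_subset ⟨hT, hTinj, hTB⟩ h𝒯
      · refine hpw.insert fun A hA _ => ⟨hno A hA, ?_⟩
        rw [inter_comm]; exact hno A hA
    exact hT (by simpa using hno T hmem)
  · intro x n
    rw [union_inter_distrib_right]
    refine (Set.encard_union_le _ _).trans ?_
    refine (add_le_add (encard_inter_cantorLevel_le_one (injOn_fst_cantorBranch x) n)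
      (encard_inter_cantorLevel_le_one (hRinj x) n)).trans ?_
    norm_num

/-! ### Pairings that split prescribed sets -/

/-- Transfinite recursion along a well-order of minimal type: each `j` has fewer than `#J`
predecessors, so their values cannot exhaust `S j`. -/
theorem exists_injective_forall_mem {J α : Type u} (S : J → Set α) (hS : ∀ j, #J ≤ #(S j)) :
    ∃ s : J → α, Function.Injective s ∧ ∀ j, s j ∈ S j := by
  obtain ⟨r, wo, hr⟩ := Cardinal.exists_ord_eq J
  have key : ∀ (j : J) (s : ∀ k, r k j → α), ∃ a ∈ S j, ∀ k hk, a ≠ s k hk := by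
    intro j s
    have hlt : #(range fun k : {k // r k j} => s k.1 k.2) < #(S j) :=
      Cardinal.mk_range_le.trans_lt ((Cardinal.card_typein_lt j hr).trans_le (hS j))
    obtain ⟨a, ha, ha'⟩ := Set.not_subset.1 fun h : S j ⊆ _ =>
      (hlt.trans_le (Cardinal.mk_le_mk_of_subset h)).false
    exact ⟨a, ha, fun k hk hak => ha' ⟨⟨k, hk⟩, hak.symm⟩⟩
  choose F hF hF' using key
  let s : J → α := wo.wf.fix F
  have hs : ∀ j, s j = F j fun k _ => s k := fun j => wo.wf.fix_eq F j
  have hne : ∀ j k, r k j → s j ≠ s k := fun j k hk => by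
    rw [hs j]; exact hF' j (fun k _ => s k) k hk
  refine ⟨s, fun j k hjk => ?_, fun j => by rw [hs]; exact hF _ _⟩
  rcases trichotomous_of r j k with h | h | h
  · exact absurd hjk.symm (hne k j h)
  · exact h
  · exact absurd hjk (hne j k h)

theorem exists_equiv_prod_bool_splitting {I α : Type u} [Infinite α] (hI : #I ≤ #α)
    (A B : I → Set α) (hA : ∀ i, #(A i) = #α) (hB : ∀ i, #(B i) = #α) :
    ∃ (K : Type u) (e : K × Bool ≃ α), ∀ i, ∃ k, e (k, false) ∈ A i ∧ e (k, true) ∈ B i := by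
  have hinf : ℵ₀ ≤ #α := Cardinal.aleph0_le_mk α
  -- The last summand reserves `#α` spare points, so that the complement of the chosen pairs has
  -- full size and can itself be paired.
  let S : (I ⊕ I) ⊕ α → Set α := Sum.elim (Sum.elim A B) fun _ => univ
  obtain ⟨s, hsinj, hs⟩ := exists_injective_forall_mem S (by
    have h1 : #((I ⊕ I) ⊕ α) ≤ #α := by
      simp only [Cardinal.mk_sum, Cardinal.lift_id]
      exact Cardinal.add_le_of_le hinf (Cardinal.add_le_of_le hinf hI hI) le_rfl
    rintro ((i | i) | a)
    · exact h1.trans (hA i).ge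
    · exact h1.trans (hB i).ge
    · simpa only [S, Sum.elim_inr, mk_univ] using h1)
  let p : I × Bool → α := fun q => s (Sum.inl (if q.2 then Sum.inr q.1 else Sum.inl q.1))
  have hp : Function.Injective p := by
    rintro ⟨i, a⟩ ⟨j, b⟩ h
    have := Sum.inl_injective (hsinj h)
    cases a <;> cases b <;> simp_all
  classical
  let L : Set α := (range p)ᶜ
  have hL : #L = #α := by
    refine le_antisymm (Cardinal.mk_set_le L) ?_
    refine Cardinal.mk_le_of_injective (f := fun a => (⟨s (Sum.inr a), ?_⟩ : L)) ?_
    · rintro ⟨q, hq⟩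
      exact absurd (hsinj hq) (by simp)
    · intro a b h
      simpa using hsinj (congrArg Subtype.val h)
  obtain ⟨eL⟩ : Nonempty (L × Bool ≃ L) := by
    rw [← Cardinal.eq, Cardinal.mk_prod, Cardinal.lift_uzero, hL]
    refine Cardinal.mul_eq_left hinf ?_ (by simp)
    exact le_trans (by simp) hinf
  refine ⟨I ⊕ L, (Equiv.sumProdDistrib I L Bool).trans
    (((Equiv.ofInjective p hp).sumCongr eL).trans (Equiv.Set.sumCompl (range p))), fun i => ?_⟩
  refine ⟨Sum.inl i, ?_, ?_⟩
  · exact hs (Sum.inl (Sum.inl i))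
  · exact hs (Sum.inl (Sum.inr i))

/-- The partition of `α` into the pairs `{e (k, false), e (k, true)}`. -/
def pairPartition {K α : Type*} (e : K × Bool ≃ α) : Set (Set α) :=
  range fun k => {e (k, false), e (k, true)}

theorem isPartition_pairPartition {K α : Type*} (e : K × Bool ≃ α) :
    Setoid.IsPartition (pairPartition e) := by
  refine ⟨?_, fun a => ?_⟩
  · rintro ⟨k, hk⟩
    exact (Set.insert_nonempty _ _).ne_empty hk
  · obtain ⟨⟨k, b⟩, rfl⟩ := e.surjective a
    refine ⟨{e (k, false), e (k, true)}, ⟨⟨k, rfl⟩, by cases b <;> simp⟩, ?_⟩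
    rintro _ ⟨⟨l, rfl⟩, hl⟩
    have : k = l := by simpa [← and_or_left] using hl
    rw [this]

theorem encard_of_mem_pairPartition {K α : Type*} (e : K × Bool ≃ α) {P : Set α}
    (hP : P ∈ pairPartition e) : P.encard = 2 := by
  obtain ⟨k, rfl⟩ := hP
  exact Set.encard_pair (by simp)

/-! ### Limits along the members of the family -/

/-- A function on the nodes that converges along every branch has a Borel limit. -/
theorem measurable_of_tendsto_cantorBranch {f : CantorTree → ℝ} {g : (ℕ → Bool) → ℝ}
    (h : ∀ x, Tendsto f (cofinite ⊓ 𝓟 (cantorBranch x)) (𝓝 (g x))) : Measurable g := by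
  refine measurable_of_tendsto_metrizable
    (f := fun n (x : ℕ → Bool) => f ⟨n, fun i => x i⟩) (fun n => ?_) ?_
  · have h1 : Measurable fun s : Fin n → Bool => f ⟨n, s⟩ := measurable_of_finite _
    exact h1.comp (measurable_pi_lambda _ fun i => measurable_pi_apply _)
  · refine tendsto_pi_nhds.2 fun x => (h x).comp ?_
    refine tendsto_inf.2 ⟨?_, tendsto_principal.2 (Eventually.of_forall fun n => ⟨n, rfl⟩)⟩
    rw [← Nat.cofinite_eq_atTop]
    exact Function.Injective.tendsto_cofinite fun _ _ h => congrArg Sigma.fst h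

/-- An uncountable standard Borel space is Borel isomorphic to the Cantor space; no continuum
hypothesis is needed. -/
theorem mk_eq_of_measurableSet_of_not_countable {A : Set (ℕ → Bool)} (hA : MeasurableSet A)
    (h : ¬ A.Countable) : #A = #(ℕ → Bool) := by
  have := hA.standardBorel
  exact Cardinal.mk_congr (PolishSpace.measurableEquivNatBoolOfNotCountable (α := A) h).toEquiv

/-- If `{x | g x ≤ a}` is countable, where `g x` is the limit of `f` along the member `M x` of a
maximal almost disjoint family, then it is finite. -/
theorem IsMADFamily.finite_of_countable {D A : Type*} {M : A → Set D} (hM : IsMADFamily M)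
    {f : D → ℝ} {g : A → ℝ} (h : ∀ x, Tendsto f (cofinite ⊓ 𝓟 (M x)) (𝓝 (g x))) (a : ℝ)
    (hc : {x | g x ≤ a}.Countable) : {x | g x ≤ a}.Finite := by
  by_contra hinf
  have hinf : {x | g x ≤ a}.Infinite := hinf
  have : Countable {x | g x ≤ a} := hc
  have := hinf.to_subtype
  obtain ⟨x⟩ : Nonempty (ℕ ≃ {x | g x ≤ a}) := nonempty_equiv_of_countable
  -- A diagonal sequence is built: its `n`-th node lies in the `n`-th member, avoids all earlier
  -- members and nodes, and has value nearly at most `a`.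
  have hex : ∀ n : ℕ, ∀ F : Finset D, ∃ t ∈ M (x n), f t < a + 1 / (n + 1) ∧ t ∉ F ∧
      ∀ m < n, t ∉ M (x m) := by
    intro n F
    have h1 : ∀ᶠ t in cofinite ⊓ 𝓟 (M (x n)), f t < a + 1 / ((n : ℝ) + 1) :=
      (h (x n)).eventually_lt_const ((x n).2.trans_lt (lt_add_of_pos_right a (by positivity)))
    have h2 : ({t | ¬ (t ∈ M (x n) → f t < a + 1 / ((n : ℝ) + 1))}).Finite :=
      eventually_inf_principal.1 h1
    have h3 : (⋃ m ∈ Iio n, M (x n) ∩ M (x m)).Finite :=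
      (Set.finite_Iio n).biUnion fun m hm => hM.almostDisjoint _ _ fun e =>
        (ne_of_lt hm) (x.injective (Subtype.ext e)).symm
    obtain ⟨t, ht, ht'⟩ := ((hM.infinite (x n)).sdiff
      ((h2.union h3).union F.finite_toSet)).nonempty
    simp only [mem_union, not_or, mem_ofPred_eq, not_not, mem_iUnion, not_exists, mem_Iio,
      mem_inter_iff, not_and, Finset.mem_coe] at ht'
    exact ⟨t, ht, ht'.1.1 ht, ht'.2, fun m hm => ht'.1.2 m hm ht⟩
  choose t ht using hex
  classical
  obtain ⟨s, hs⟩ : ∃ s : ℕ → D, ∀ n, s n ∈ M (x n) ∧ f (s n) < a + 1 / (n + 1) ∧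
      (∀ m < n, s n ≠ s m) ∧ ∀ m < n, s n ∉ M (x m) := by
    let s : ℕ → D := fun n => Nat.strongRec (motive := fun _ => D)
      (fun n ih => t n (Finset.univ.image fun m : Fin n => ih m m.2)) n
    refine ⟨s, fun n => ?_⟩
    have hn : s n = t n (Finset.univ.image fun m : Fin n => s m) := by
      simp only [s]; rw [Nat.strongRec]
    have := ht n (Finset.univ.image fun m : Fin n => s m)
    rw [← hn] at this
    refine ⟨this.1, this.2.1, fun m hm e => this.2.2.1 ?_, this.2.2.2⟩
    exact Finset.mem_image.2 ⟨⟨m, hm⟩, Finset.mem_univ _, e.symm⟩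
  have hsinj : Function.Injective s := by
    intro m n hmn
    by_contra hne
    rcases lt_or_gt_of_ne hne with h | h
    · exact (hs n).2.2.1 m h hmn.symm
    · exact (hs m).2.2.1 n h hmn
  -- The member `M y` caught by maximality has limit at most `a`, so `y = x m` for some `m`; but `s`
  -- avoids `M (x m)` after index `m`.
  obtain ⟨y, hy⟩ := hM.maximal (range s) (Set.infinite_range_of_injective hsinj)
  have hy' : {n | s n ∈ M y}.Infinite := by
    intro hfin
    refine hy ((hfin.image s).subset ?_)
    rintro _ ⟨⟨n, rfl⟩, hn⟩
    exact ⟨n, hn, rfl⟩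
  have hya : g y ≤ a := by
    have hl : (atTop ⊓ 𝓟 {n | s n ∈ M y}).NeBot := by
      rw [← frequently_mem_iff_neBot]
      exact Nat.frequently_atTop_iff_infinite.2 hy'
    have h1 : Tendsto (fun n => f (s n)) (atTop ⊓ 𝓟 {n | s n ∈ M y}) (𝓝 (g y)) := by
      refine (h y).comp (tendsto_inf.2 ⟨?_, ?_⟩)
      · exact (Nat.cofinite_eq_atTop ▸ hsinj.tendsto_cofinite).mono_left inf_le_left
      · exact tendsto_principal.2 (eventually_inf_principal.2 (Eventually.of_forall fun n hn => hn))
    have h2 : Tendsto (fun n : ℕ => a + 1 / ((n : ℝ) + 1)) (atTop ⊓ 𝓟 {n | s n ∈ M y})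
        (𝓝 (a + 0)) :=
      (tendsto_const_nhds.add tendsto_one_div_add_atTop_nhds_zero_nat).mono_left inf_le_left
    simpa using le_of_tendsto_of_tendsto' h1 h2 fun n => (hs n).2.1.le
  obtain ⟨m, hm⟩ := x.surjective ⟨y, hya⟩
  refine hy' ((Set.finite_Iic m).subset fun n hn => ?_)
  by_contra hmn
  rw [mem_Iic, not_le] at hmn
  exact (hs n).2.2.2 m hmn (by rw [hm]; exact hn)

/-- This count lets a single pairing handle all functions and all pairs of thresholds. -/
theorem mk_cantorTree_fun_prod : #((CantorTree → ℝ) × ℝ × ℝ) ≤ #(ℕ → Bool) := by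
  have h1 : #(ℕ → Bool) = 𝔠 := by simp
  have h2 : #CantorTree = ℵ₀ := Cardinal.mk_eq_aleph0 _
  rw [h1, Cardinal.mk_prod, Cardinal.mk_prod, ← Cardinal.power_def, h2]
  simp [Cardinal.mk_real]

/-- A maximal almost disjoint family that contains the branches can be paired so that a function
with equal limits along paired members has, off a finite set of members, almost constant limit. -/
theorem exists_pairing {D : (ℕ → Bool) → Set CantorTree} (hD : ∀ x, cantorBranch x ⊆ D x)
    (hM : IsMADFamily D) : ∃ Q : Set (Set (ℕ → Bool)), Setoid.IsPartition Q ∧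
      (∀ P ∈ Q, P.encard = 2) ∧ ∀ (f : CantorTree → ℝ) (g : (ℕ → Bool) → ℝ),
        (∀ x, Tendsto f (cofinite ⊓ 𝓟 (D x)) (𝓝 (g x))) →
        (∀ P ∈ Q, ∀ x ∈ P, ∀ y ∈ P, g x = g y) → ∀ a b, a < b →
          {x | g x ≤ a}.Finite ∨ {x | b ≤ g x}.Finite := by
  -- The pairing is fixed before any function, so the limit is quantified existentially: an
  -- arbitrary function on the nodes need not converge.
  let A : (CantorTree → ℝ) × ℝ × ℝ → Set (ℕ → Bool) := fun q =>
    {x | ∃ l ≤ q.2.1, Tendsto q.1 (cofinite ⊓ 𝓟 (D x)) (𝓝 l)}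
  let B : (CantorTree → ℝ) × ℝ × ℝ → Set (ℕ → Bool) := fun q =>
    {x | ∃ l, q.2.2 ≤ l ∧ Tendsto q.1 (cofinite ⊓ 𝓟 (D x)) (𝓝 l)}
  obtain ⟨K, e, he⟩ := exists_equiv_prod_bool_splitting
    (I := {q // #(A q) = #(ℕ → Bool) ∧ #(B q) = #(ℕ → Bool)})
    ((Cardinal.mk_subtype_le _).trans mk_cantorTree_fun_prod) (fun q => A q) (fun q => B q)
    (fun q => q.2.1) (fun q => q.2.2)
  refine ⟨pairPartition e, isPartition_pairPartition e,
    fun P hP => encard_of_mem_pairPartition e hP, fun f g hfg hQ a b hab => ?_⟩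
  by_contra! hinf
  have hne : ∀ x, (cofinite ⊓ 𝓟 (D x)).NeBot := fun x =>
    (hM.infinite x).cofinite_inf_principal_neBot
  have hA : A (f, a, b) = {x | g x ≤ a} := by
    ext x
    have := hne x
    exact ⟨fun ⟨l, hl, hfl⟩ => mem_ofPred_eq.mpr (tendsto_nhds_unique hfl (hfg x) ▸ hl), fun hx => ⟨_, hx, hfg x⟩⟩
  have hB : B (f, a, b) = {x | b ≤ g x} := by
    ext x
    have := hne x
    exact ⟨fun ⟨l, hl, hfl⟩ => mem_ofPred_eq.mpr (tendsto_nhds_unique hfl (hfg x) ▸ hl), fun hx => ⟨_, hx, hfg x⟩⟩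
  have hg : Measurable g := measurable_of_tendsto_cantorBranch fun x =>
    (hfg x).mono_left (inf_le_inf_left _ (principal_mono.2 (hD x)))
  have hcA : #(A (f, a, b)) = #(ℕ → Bool) := by
    rw [hA]
    refine mk_eq_of_measurableSet_of_not_countable (measurableSet_le hg measurable_const) ?_
    exact fun hc => hinf.1 (hM.finite_of_countable hfg a hc)
  have hcB : #(B (f, a, b)) = #(ℕ → Bool) := by
    rw [hB]
    refine mk_eq_of_measurableSet_of_not_countable (measurableSet_le measurable_const hg) ?_
    intro hc
    have := hM.finite_of_countable (fun x => (hfg x).neg) (-b) (by simpa using hc)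
    exact hinf.2 (by simpa using this)
  obtain ⟨k, hkA, hkB⟩ := he ⟨(f, a, b), hcA, hcB⟩
  have hkA : g (e (k, false)) ≤ a := by rw [hA] at hkA; exact hkA
  have hkB : b ≤ g (e (k, true)) := by rw [hB] at hkB; exact hkB
  have := hQ _ ⟨k, rfl⟩ (e (k, false)) (by simp) (e (k, true)) (by simp)
  linarith

/-- Merging the members of a maximal almost disjoint family along a partition into finite sets. -/
theorem IsMADFamily.merge {D A : Type*} {M : A → Set D} (hM : IsMADFamily M) {Q : Set (Set A)}
    (hQ : Setoid.IsPartition Q) (hfin : ∀ P ∈ Q, P.Finite) :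
    IsMADFamily fun P : Q => ⋃ x ∈ P.1, M x := by
  refine ⟨fun P => ?_, fun P R hPR => ?_, fun S hS => ?_⟩
  · obtain ⟨x, hx⟩ := Setoid.nonempty_of_mem_partition hQ P.2
    exact (hM.infinite x).mono (subset_biUnion_of_mem (u := M) hx)
  · have hdis : Disjoint P.1 R.1 :=
      hQ.pairwiseDisjoint P.2 R.2 fun h => hPR (Subtype.ext h)
    simp only [iUnion_inter, inter_iUnion]
    exact (hfin R R.2).biUnion fun y hy => (hfin P P.2).biUnion fun x hx =>
      hM.almostDisjoint x y (hdis.ne_of_mem hx hy)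
  · obtain ⟨x, hx⟩ := hM.maximal S hS
    obtain ⟨P, ⟨hP, hxP⟩, -⟩ := hQ.2 x
    exact ⟨⟨P, hP⟩, hx.mono (inter_subset_inter_right _ (subset_biUnion_of_mem (u := M) hxP))⟩

/-! ### The topology of `Ψ`-spaces -/

namespace PsiSpace

variable {D A : Type*} {M : A → Set D}

@[elab_as_elim]
theorem rec_node_index {p : PsiSpace M → Prop} (node : ∀ u, p (ofNode M u))
    (index : ∀ α, p (ofIndex M α)) (x : PsiSpace M) : p x := by
  rcases x with u | α
  · exact node u
  · exact index α

theorem ofNode_injective : Function.Injective (ofNode M) := Sum.inl_injective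

theorem ofIndex_injective : Function.Injective (ofIndex M) := Sum.inr_injective

@[simp] theorem ofNode_inj {u v : D} : ofNode M u = ofNode M v ↔ u = v :=
  ofNode_injective.eq_iff

@[simp] theorem ofIndex_inj {α β : A} : ofIndex M α = ofIndex M β ↔ α = β :=
  ofIndex_injective.eq_iff

@[simp] theorem ofNode_ne_ofIndex (u : D) (α : A) : ofNode M u ≠ ofIndex M α := Sum.inl_ne_inr

@[simp] theorem ofIndex_ne_ofNode (u : D) (α : A) : ofIndex M α ≠ ofNode M u := Sum.inr_ne_inl

variable (M) in
/-- The basic neighbourhoods: `{u}` for a node `u` and `{α} ∪ M α` for an index `α`. -/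
def basicNhd : PsiSpace M → Set (PsiSpace M)
  | Sum.inl u => {ofNode M u}
  | Sum.inr α => insert (ofIndex M α) (ofNode M '' M α)

@[simp] theorem basicNhd_ofNode (u : D) : basicNhd M (ofNode M u) = {ofNode M u} := rfl

@[simp] theorem basicNhd_ofIndex (α : A) :
    basicNhd M (ofIndex M α) = insert (ofIndex M α) (ofNode M '' M α) := rfl

@[simp] theorem ofNode_mem_basicNhd_ofIndex {u : D} {α : A} :
    ofNode M u ∈ basicNhd M (ofIndex M α) ↔ u ∈ M α := by simp

@[simp] theorem ofIndex_mem_basicNhd {x : PsiSpace M} {α : A} :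
    ofIndex M α ∈ basicNhd M x ↔ x = ofIndex M α := by
  induction x using rec_node_index with
  | node u => simp
  | index β => simp [eq_comm]

theorem mem_basicNhd (x : PsiSpace M) : x ∈ basicNhd M x := by
  induction x using rec_node_index <;> simp

theorem isOpen_singleton_ofNode (u : D) : IsOpen {ofNode M u} :=
  TopologicalSpace.isOpen_generateFrom_of_mem (Or.inl (Or.inl ⟨u, rfl⟩))

theorem isOpen_basicNhd (x : PsiSpace M) : IsOpen (basicNhd M x) := by
  induction x using rec_node_index with
  | node u => exact isOpen_singleton_ofNode u
  | index α => exact TopologicalSpace.isOpen_generateFrom_of_mem (Or.inr ⟨α, rfl⟩)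

theorem isClosed_singleton_ofNode (u : D) : IsClosed {ofNode M u} :=
  ⟨TopologicalSpace.isOpen_generateFrom_of_mem (Or.inl (Or.inr ⟨u, rfl⟩))⟩

/-- Traces of subbasic sets on `M α` are cofinite when they contain `α`. Conversely, removing
finitely many closed nodes from a basic neighbourhood leaves it open. -/
theorem isOpen_iff {U : Set (PsiSpace M)} :
    IsOpen U ↔ ∀ α, ofIndex M α ∈ U → {u ∈ M α | ofNode M u ∉ U}.Finite := by
  constructor
  · intro hU α hα
    induction hU with
    | basic s hs =>
      rcases hs with (⟨u, rfl⟩ | ⟨u, rfl⟩) | ⟨β, rfl⟩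
      · simp at hα
      · refine (Set.finite_singleton u).subset ?_
        rintro v ⟨-, hv⟩
        simpa using hv
      · obtain rfl : α = β := by simpa using hα
        refine Set.finite_empty.subset ?_
        rintro v ⟨hv, hv'⟩
        simp [hv] at hv'
    | univ => simp
    | inter s t _ _ hs ht =>
      refine ((hs hα.1).union (ht hα.2)).subset ?_
      rintro v ⟨hv, hv'⟩
      by_cases h : ofNode M v ∈ s
      · exact Or.inr ⟨hv, fun h' => hv' ⟨h, h'⟩⟩
      · exact Or.inl ⟨hv, h⟩
    | sUnion S _ hS =>
      obtain ⟨s, hs, hαs⟩ := hα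
      refine (hS s hs hαs).subset ?_
      rintro v ⟨hv, hv'⟩
      exact ⟨hv, fun h => hv' ⟨s, hs, h⟩⟩
  · intro h
    rw [isOpen_iff_forall_mem_open]
    intro x
    induction x using rec_node_index with
    | node u => exact fun hu => ⟨{ofNode M u}, by simpa using hu, isOpen_singleton_ofNode u, rfl⟩
    | index α =>
      intro hα
      refine ⟨basicNhd M (ofIndex M α) \ ⋃ u ∈ {u ∈ M α | ofNode M u ∉ U}, {ofNode M u}, ?_,
        (isOpen_basicNhd _).sdiff ((h α hα).isClosed_biUnion fun u _ =>
          isClosed_singleton_ofNode u), ?_⟩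
      · rintro _ ⟨rfl | ⟨u, hu, rfl⟩, hx⟩
        · exact hα
        · by_contra hU
          exact hx (mem_biUnion (⟨hu, hU⟩ : u ∈ {u ∈ M α | ofNode M u ∉ U}) rfl)
      · exact ⟨by simp, by simp⟩

theorem tendsto_ofNode (α : A) :
    Tendsto (ofNode M) (cofinite ⊓ 𝓟 (M α)) (𝓝 (ofIndex M α)) := by
  rw [tendsto_nhds]
  intro U hU hα
  rw [mem_inf_principal, mem_cofinite]
  refine (isOpen_iff.1 hU α hα).subset fun u hu => ?_
  simpa using hu

theorem exists_ofNode_mem (hM : IsMADFamily M) {U : Set (PsiSpace M)} (hU : IsOpen U)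
    (hne : U.Nonempty) : ∃ u, ofNode M u ∈ U := by
  obtain ⟨x, hx⟩ := hne
  induction x using rec_node_index with
  | node u => exact ⟨u, hx⟩
  | index α =>
    obtain ⟨u, hu, hu'⟩ := ((hM.infinite α).sdiff (isOpen_iff.1 hU α hx)).nonempty
    exact ⟨u, by_contra fun h => hu' ⟨hu, h⟩⟩

theorem isClopen_basicNhd (hM : IsMADFamily M) (x : PsiSpace M) : IsClopen (basicNhd M x) := by
  refine ⟨?_, isOpen_basicNhd x⟩
  induction x using rec_node_index with
  | node u => exact isClosed_singleton_ofNode u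
  | index α =>
    rw [← isOpen_compl_iff, isOpen_iff]
    intro β hβ
    refine (hM.almostDisjoint α β fun h => ?_).subset ?_
    · simp [h] at hβ
    · rintro u ⟨hu, hu'⟩
      exact ⟨by simpa using hu', hu⟩

theorem isCompact_basicNhd (x : PsiSpace M) : IsCompact (basicNhd M x) := by
  induction x using rec_node_index with
  | node u => exact isCompact_singleton
  | index α =>
    have : Tendsto (fun u : M α => ofNode M u) cofinite (𝓝 (ofIndex M α)) := by
      refine (tendsto_ofNode α).comp (tendsto_inf.2 ⟨?_, ?_⟩)
      · exact Subtype.val_injective.tendsto_cofinite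
      · exact tendsto_principal.2 (Eventually.of_forall fun u => u.2)
    convert this.isCompact_insert_range_of_cofinite using 2
    ext; simp

theorem totallySeparatedSpace (hM : IsMADFamily M) : TotallySeparatedSpace (PsiSpace M) := by
  refine totallySeparatedSpace_iff_exists_isClopen.2 fun x y hxy => ?_
  induction x using rec_node_index with
  | node u => exact ⟨_, isClopen_basicNhd hM (ofNode M u), mem_basicNhd _, fun h => hxy h.symm⟩
  | index α =>
    induction y using rec_node_index with
    | node v =>
      exact ⟨_, (isClopen_basicNhd hM (ofNode M v)).compl, hxy, fun h => h (mem_basicNhd _)⟩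
    | index β =>
      exact ⟨_, isClopen_basicNhd hM (ofIndex M α), mem_basicNhd _, by simpa using Ne.symm hxy⟩

theorem locallyCompactSpace (hM : IsMADFamily M) : LocallyCompactSpace (PsiSpace M) := by
  have := totallySeparatedSpace hM
  have : WeaklyLocallyCompactSpace (PsiSpace M) :=
    ⟨fun x => ⟨_, isCompact_basicNhd x, (isOpen_basicNhd x).mem_nhds (mem_basicNhd x)⟩⟩
  infer_instance

theorem t35Space (hM : IsMADFamily M) : T35Space (PsiSpace M) := by
  have := totallySeparatedSpace hM
  have := locallyCompactSpace hM
  have : CompletelyRegularSpace (PsiSpace M) :=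
    CompletelyRegularSpace.of_isTopologicalBasis_clopens loc_compact_Haus_tot_disc_of_zero_dim
  exact {}

theorem exists_finset_subset_biUnion_basicNhd {K : Set (PsiSpace M)} (hK : IsCompact K) :
    ∃ t : Finset (PsiSpace M), K ⊆ ⋃ x ∈ t, basicNhd M x := by
  obtain ⟨t, -, ht⟩ := hK.elim_nhds_subcover (basicNhd M) fun x _ =>
    (isOpen_basicNhd x).mem_nhds (mem_basicNhd x)
  exact ⟨t, ht⟩

theorem isOpen_singleton_iff (hM : IsMADFamily M) {x : PsiSpace M} :
    IsOpen {x} ↔ x ∈ range (ofNode M) := by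
  constructor
  · intro h
    obtain ⟨u, hu⟩ := exists_ofNode_mem hM h (singleton_nonempty x)
    exact ⟨u, hu⟩
  · rintro ⟨u, rfl⟩
    exact isOpen_singleton_ofNode u

theorem dense_range_ofNode (hM : IsMADFamily M) : Dense (range (ofNode M)) := by
  rw [dense_iff_inter_open]
  intro U hU hne
  obtain ⟨u, hu⟩ := exists_ofNode_mem hM hU hne
  exact ⟨_, hu, u, rfl⟩

theorem discreteTopology_nonisolated (hM : IsMADFamily M) :
    DiscreteTopology {x : PsiSpace M | ¬ IsOpen ({x} : Set (PsiSpace M))} := by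
  rw [discreteTopology_subtype_iff']
  intro x hx
  refine ⟨basicNhd M x, isOpen_basicNhd x, ?_⟩
  ext y
  simp only [mem_inter_iff, mem_ofPred_eq, isOpen_singleton_iff hM, mem_singleton_iff]
  induction y using rec_node_index with
  | node v =>
    constructor
    · exact fun h => absurd ⟨v, rfl⟩ h.2
    · rintro rfl
      exact absurd (isOpen_singleton_ofNode v) hx
  | index β =>
    simp only [ofIndex_mem_basicNhd]
    exact ⟨fun h => h.1.symm, fun h => ⟨h.symm, by simp⟩⟩

/-! ### Pseudocompactness of the powers -/

/-- Either some node recurs infinitely often, or the fibres are finite and maximality supplies a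
member containing infinitely many of the nodes, which converge to its index. -/
theorem exists_infinite_subset_tendsto (hM : IsMADFamily M) (d : ℕ → D) {S : Set ℕ}
    (hS : S.Infinite) : ∃ T ⊆ S, T.Infinite ∧ ∃ y : PsiSpace M,
      Tendsto (fun n => ofNode M (d n)) (atTop ⊓ 𝓟 T) (𝓝 y) := by
  by_cases hfib : ∃ u, {n ∈ S | d n = u}.Infinite
  · obtain ⟨u, hu⟩ := hfib
    refine ⟨_, sep_subset _ _, hu, ofNode M u, tendsto_const_nhds.congr' ?_⟩
    filter_upwards [mem_inf_of_right (mem_principal_self _)] with n hn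
    rw [hn.2]
  simp only [not_exists, Set.not_infinite] at hfib
  have himg : (d '' S).Infinite := fun hfin =>
    hS ((hfin.biUnion fun u _ => hfib u).subset fun n hn =>
      mem_biUnion (mem_image_of_mem d hn) ⟨hn, rfl⟩)
  obtain ⟨α, hα⟩ := hM.maximal _ himg
  refine ⟨{n ∈ S | d n ∈ M α}, sep_subset _ _, fun hfin => hα ((hfin.image d).subset ?_),
    ofIndex M α, (tendsto_ofNode α).comp (tendsto_inf.2 ⟨?_, ?_⟩)⟩
  · rintro _ ⟨⟨n, hn, rfl⟩, hnα⟩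
    exact ⟨n, ⟨hn, hnα⟩, rfl⟩
  · rw [← Nat.cofinite_eq_atTop]
    intro V hV
    rw [mem_map, mem_inf_principal, mem_cofinite]
    refine ((mem_cofinite.1 hV).biUnion fun u _ => hfib u).subset fun n hn => ?_
    simp only [mem_compl_iff, mem_ofPred_eq, not_forall, mem_preimage] at hn
    obtain ⟨⟨hnS, -⟩, hnV⟩ := hn
    exact mem_biUnion (show d n ∈ Vᶜ from hnV) ⟨hnS, rfl⟩
  · exact tendsto_principal.2 (eventually_inf_principal.2 (Eventually.of_forall fun n hn => hn.2))

end PsiSpace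

/-- Diagonal sequences: if each of countably many sequences subconverges along every infinite set
of indices, then they converge along a common subsequence. -/
theorem exists_strictMono_forall_tendsto {Y : Type*} [TopologicalSpace Y] (d : ℕ → ℕ → Y)
    (h : ∀ j, ∀ S : Set ℕ, S.Infinite → ∃ T ⊆ S, T.Infinite ∧
      ∃ y, Tendsto (d j) (atTop ⊓ 𝓟 T) (𝓝 y)) :
    ∃ φ : ℕ → ℕ, StrictMono φ ∧ ∀ j, ∃ y, Tendsto (fun k => d j (φ k)) atTop (𝓝 y) := by
  choose T hTS hT hlim using h
  let s : ℕ → {S : Set ℕ // S.Infinite} := fun j => Nat.rec ⟨T 0 univ infinite_univ, hT _ _ _⟩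
    (fun j S => ⟨T (j + 1) S.1 S.2, hT _ _ _⟩) j
  have hanti : Antitone fun j => (s j).1 := antitone_nat_of_succ_le fun j => hTS _ _ _
  have hs : ∀ j, ∃ y, Tendsto (d j) (atTop ⊓ 𝓟 (s j).1) (𝓝 y) := by
    rintro (_ | j)
    · exact hlim _ _ _
    · exact hlim _ _ _
  -- Since the index sets decrease, `φ k` lies in the `j`-th one for all `k ≥ j`.
  obtain ⟨φ, hφ, hφs⟩ := extraction_forall_of_frequently (P := fun n k => k ∈ (s n).1)
    fun n => Nat.frequently_atTop_iff_infinite.2 (s n).2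
  refine ⟨φ, hφ, fun j => ?_⟩
  obtain ⟨y, hy⟩ := hs j
  refine ⟨y, hy.comp (tendsto_inf.2 ⟨hφ.tendsto_atTop, tendsto_principal.2 ?_⟩)⟩
  filter_upwards [eventually_ge_atTop j] with k hk using hanti hk (hφs k)

/-- An unbounded function is already unbounded on points with node coordinates that equal `d₀` off a
finite set. A sequence of such points varies in countably many coordinates only, so a diagonal
subsequence converges, contradicting the growth of `|f|`. -/
theorem PsiSpace.isPseudocompact_pi {D A : Type*} [Nonempty D] {M : A → Set D}
    (hM : IsMADFamily M) (ι : Type*) : IsPseudocompact (ι → PsiSpace M) := by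
  intro f hf
  rcases isEmpty_or_nonempty ι with hι | hι
  · exact ⟨|f isEmptyElim|, fun x => by rw [Subsingleton.elim x isEmptyElim]⟩
  by_contra! hunb
  let d₀ : D := Classical.arbitrary D
  have hp : ∀ n : ℕ, ∃ (F : Finset ι) (p : ι → D), (∀ i ∉ F, p i = d₀) ∧
      (n : ℝ) < |f fun i => ofNode M (p i)| := by
    intro n
    obtain ⟨x, hx⟩ := hunb n
    obtain ⟨F, U, hU, hUf⟩ := isOpen_pi_iff.1 (isOpen_lt continuous_const hf.abs :
      IsOpen {x | (n : ℝ) < |f x|}) x hx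
    have : ∀ i, ∃ u, i ∈ F → ofNode M u ∈ U i := by
      intro i
      by_cases hi : i ∈ F
      · obtain ⟨u, hu⟩ := exists_ofNode_mem hM (hU i hi).1 ⟨_, (hU i hi).2⟩
        exact ⟨u, fun _ => hu⟩
      · exact ⟨d₀, fun h => absurd h hi⟩
    choose p hp using this
    classical
    refine ⟨F, fun i => if i ∈ F then p i else d₀, fun i hi => if_neg hi, ?_⟩
    refine hUf (a := fun i => ofNode M (if i ∈ F then p i else d₀)) fun i hi => ?_
    have hi : i ∈ F := hi
    simpa [hi] using hp i hi
  choose F p hpF hp using hp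
  obtain ⟨e, he⟩ := Set.countable_iff_exists_subset_range.1
    (Set.countable_iUnion fun n => (F n).countable_toSet)
  obtain ⟨φ, hφ, hlim⟩ := exists_strictMono_forall_tendsto (fun j n => ofNode M (p n (e j)))
    fun j S hS => exists_infinite_subset_tendsto hM (fun n => p n (e j)) hS
  have hlim' : ∀ i, ∃ y, Tendsto (fun k => ofNode M (p (φ k) i)) atTop (𝓝 y) := by
    intro i
    by_cases hi : i ∈ range e
    · obtain ⟨j, rfl⟩ := hi
      exact hlim j
    · refine ⟨ofNode M d₀, tendsto_const_nhds.congr fun k => ?_⟩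
      rw [hpF]
      exact fun hk => hi (he (mem_iUnion.2 ⟨φ k, hk⟩))
  choose q hq using hlim'
  have hlimf : Tendsto (fun k => |f fun i => ofNode M (p (φ k) i)|) atTop (𝓝 |f q|) :=
    (hf.abs.tendsto q).comp (tendsto_pi_nhds.2 hq)
  refine not_tendsto_nhds_of_tendsto_atTop ?_ _ hlimf
  refine tendsto_atTop_mono (fun k => ?_) tendsto_natCast_atTop_atTop
  exact (Nat.cast_le.2 (hφ.id_le k)).trans (hp (φ k)).le

namespace PsiSpace

/-! ### The Stone–Čech remainder -/

variable {D A : Type*} {M : A → Set D}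

/-- Only finitely many nodes of the sublevel set miss the finitely many members concerned:
infinitely many would meet some `M β` infinitely, forcing `f ≤ a` at `β`. -/
theorem isCompact_le_of_finite (hM : IsMADFamily M) {f : PsiSpace M → ℝ} (hf : Continuous f)
    {a : ℝ} (hfin : {α | f (ofIndex M α) ≤ a}.Finite) : IsCompact {x | f x ≤ a} := by
  have hZ : {u | f (ofNode M u) ≤ a ∧ ∀ α, f (ofIndex M α) ≤ a → u ∉ M α}.Finite := by
    by_contra hinf
    obtain ⟨β, hβ⟩ := hM.maximal _ hinf
    have hle : f (ofIndex M β) ≤ a := by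
      have hne := (hβ.mono inter_subset_right).cofinite_inf_principal_neBot
      have hlim := (hf.tendsto _).comp (tendsto_ofNode (M := M) β)
      refine le_of_tendsto_of_frequently hlim ?_
      rw [frequently_inf_principal, frequently_cofinite_iff_infinite]
      exact hβ.mono fun u hu => ⟨hu.2, hu.1.1⟩
    obtain ⟨u, hu⟩ := hβ.nonempty
    exact hu.1.2 β hle hu.2
  refine ((hfin.isCompact_biUnion fun α _ => isCompact_basicNhd (ofIndex M α)).union
    (hZ.image (ofNode M)).isCompact).of_isClosed_subset (isClosed_le hf continuous_const) ?_
  intro x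
  induction x using rec_node_index with
  | node u =>
    intro hu
    by_cases h : ∃ α, f (ofIndex M α) ≤ a ∧ u ∈ M α
    · obtain ⟨α, hα, huα⟩ := h
      exact Or.inl (mem_biUnion (show α ∈ {α | f (ofIndex M α) ≤ a} from hα) (by simpa using huα))
    · exact Or.inr ⟨u, ⟨hu, fun α hα huα => h ⟨α, hα, huα⟩⟩, rfl⟩
  | index α =>
    intro hα
    exact Or.inl (mem_biUnion (show α ∈ {α | f (ofIndex M α) ≤ a} from hα) (mem_basicNhd _))

theorem not_compactSpace [Infinite A] : ¬ CompactSpace (PsiSpace M) := by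
  intro h
  obtain ⟨t, ht⟩ := exists_finset_subset_biUnion_basicNhd (isCompact_univ (X := PsiSpace M))
  refine Set.infinite_range_of_injective (ofIndex_injective (M := M)) (t.finite_toSet.subset ?_)
  rintro _ ⟨α, rfl⟩
  have := ht (mem_univ (ofIndex M α))
  simp only [mem_iUnion, ofIndex_mem_basicNhd] at this
  obtain ⟨x, hx, rfl⟩ := this
  exact hx

end PsiSpace

/-- By density, `{g < a}` lies in the closure of the image of the sublevel set, and this compact
image is already closed. -/
theorem stoneCech_mem_range_of_lt {X : Type*} [TopologicalSpace X] {g : StoneCech X → ℝ}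
    (hg : Continuous g) {a : ℝ} (hK : IsCompact {x : X | g (stoneCechUnit x) ≤ a})
    {p : StoneCech X} (hp : g p < a) : p ∈ range (stoneCechUnit : X → StoneCech X) := by
  by_contra hpr
  have hcl := (hK.image continuous_stoneCechUnit).isClosed
  have hopen : IsOpen ({q | g q < a} \ stoneCechUnit '' {x : X | g (stoneCechUnit x) ≤ a}) :=
    (isOpen_lt hg continuous_const).sdiff hcl
  obtain ⟨_, ⟨h1, h2⟩, x, rfl⟩ := denseRange_stoneCechUnit.inter_open_nonempty _ hopen
    ⟨p, hp, fun ⟨x, _, hx⟩ => hpr ⟨x, hx⟩⟩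
  exact h2 ⟨x, le_of_lt (mem_ofPred_eq.mp h1), rfl⟩

/-- A function separating two remainder points would have a compact sublevel or superlevel set in
`X`, placing one of the points in `X`. -/
theorem PsiSpace.exists_remainder_eq_singleton {D A : Type*} [Infinite A] {M : A → Set D}
    (hM : IsMADFamily M)
    (hsplit : ∀ f : PsiSpace M → ℝ, Continuous f → ∀ a b, a < b →
      {α | f (ofIndex M α) ≤ a}.Finite ∨ {α | b ≤ f (ofIndex M α)}.Finite) :
    ∃ p, (range (stoneCechUnit : PsiSpace M → StoneCech (PsiSpace M)))ᶜ = {p} := by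
  have := t35Space hM
  have hne : (range (stoneCechUnit : PsiSpace M → StoneCech (PsiSpace M)))ᶜ.Nonempty := by
    rw [nonempty_compl]
    intro h
    refine not_compactSpace (M := M) ⟨?_⟩
    rw [isEmbedding_stoneCechUnit.isCompact_iff, image_univ, h]
    exact isCompact_univ
  obtain ⟨p, hp⟩ := hne
  refine ⟨p, Subset.antisymm (fun q hq => ?_) (singleton_subset_iff.2 hp)⟩
  by_contra hqp
  obtain ⟨g, hg0, hg1, -⟩ := exists_continuous_zero_one_of_isClosed
    (isClosed_singleton (x := p)) (isClosed_singleton (x := q))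
    (disjoint_singleton.2 fun h => hqp h.symm)
  have hg0 : g p = 0 := hg0 rfl
  have hg1 : g q = 1 := hg1 rfl
  have hcont := g.continuous.comp (continuous_stoneCechUnit (α := PsiSpace M))
  rcases hsplit _ hcont (1 / 3) (2 / 3) (by norm_num) with h | h
  · exact hp (stoneCech_mem_range_of_lt g.continuous (isCompact_le_of_finite hM hcont h)
      (by rw [hg0]; norm_num))
  · refine hq (stoneCech_mem_range_of_lt (g := fun x => - g x) (a := -(2 / 3)) g.continuous.neg
      (isCompact_le_of_finite hM hcont.neg ?_) (by rw [hg1]; norm_num))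
    refine h.subset fun α hα => ?_
    exact le_of_neg_le_neg (mem_ofPred_eq.mp hα)

theorem PsiSpace.isMrowkaSpace {D A : Type*} [Countable D] [Infinite A] {M : A → Set D}
    (hM : IsMADFamily M)
    (hsplit : ∀ f : PsiSpace M → ℝ, Continuous f → ∀ a b, a < b →
      {α | f (ofIndex M α) ≤ a}.Finite ∨ {α | b ≤ f (ofIndex M α)}.Finite) :
    IsMrowkaSpace (PsiSpace M) where
  tychonoff := t35Space hM
  countable_isolated := by
    simp only [isOpen_singleton_iff hM]
    exact countable_range (ofNode M)
  dense_isolated := by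
    simp only [isOpen_singleton_iff hM]
    exact dense_range_ofNode hM
  discrete_nonisolated := discreteTopology_nonisolated hM
  remainder := Set.encard_eq_one.2 (exists_remainder_eq_singleton hM hsplit)

/-! ### Weak topology and extensions -/

theorem continuous_radonProb_apply_of_isClopen {Y : Type*} [TopologicalSpace Y]
    [MeasurableSpace Y] [BorelSpace Y] {C : Set Y} (hC : IsClopen C) :
    Continuous fun ν : RadonProb Y => (ν.1 : Measure Y).real C := by
  have h := (ProbabilityMeasure.continuous_integral_boundedContinuousFunction
    (BoundedContinuousFunction.indicator C hC)).comp
      (continuous_subtype_val (p := fun μ : ProbabilityMeasure Y => (μ : Measure Y).InnerRegular))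
  refine h.congr fun ν => ?_
  exact integral_indicator_one hC.isOpen.measurableSet

theorem continuous_radonToStoneCech (X : Type*) [TopologicalSpace X] [MeasurableSpace X]
    [BorelSpace X] : Continuous (radonToStoneCech X) :=
  ((ProbabilityMeasure.continuous_map continuous_stoneCechUnit).comp
    continuous_subtype_val).subtype_mk _

theorem isCStarEmbedded_of_stoneCechCommutes (X : Type*) [TopologicalSpace X] [MeasurableSpace X]
    [BorelSpace X] (h : StoneCechCommutesWithRadonProb X) :
    IsCStarEmbedded (radonToStoneCech X) := by
  obtain ⟨h, hh⟩ := h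
  rintro f hf ⟨C, hC⟩
  let f' : RadonProb X → Icc (-C) C := fun μ => ⟨f μ, abs_le.1 (hC μ)⟩
  have hf' : Continuous f' := hf.subtype_mk _
  refine ⟨fun ν => (stoneCechExtend hf' (h.symm ν)).1, ?_, fun μ => ?_⟩
  · exact continuous_subtype_val.comp ((continuous_stoneCechExtend hf').comp h.symm.continuous)
  · simp only [← hh, h.symm_apply_apply, stoneCechExtend_stoneCechUnit, f']

/-- The canonical map `P(X) → P_τ(X)`. -/
def radonToTau (X : Type*) [TopologicalSpace X] [MeasurableSpace X] [BorelSpace X]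
    (μ : RadonProb X) : RadonProbTau X :=
  ⟨radonToStoneCech X μ, fun K hK hKX => by
    have hpre : (stoneCechUnit : X → StoneCech X) ⁻¹' K = ∅ :=
      eq_empty_of_forall_notMem fun x hx => hKX hx ⟨x, rfl⟩
    change (μ.1 : Measure X).map stoneCechUnit K = 0
    rw [Measure.map_apply continuous_stoneCechUnit.measurable hK.measurableSet, hpre,
      measure_empty]⟩

theorem continuous_radonToTau (X : Type*) [TopologicalSpace X] [MeasurableSpace X]
    [BorelSpace X] : Continuous (radonToTau X) :=
  (continuous_radonToStoneCech X).subtype_mk _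

/-- Compact `Gδ`-sets of the remainder of a pseudocompact space are empty. -/
theorem IsPseudocompact.eq_empty_of_isGδ {X : Type*} [TopologicalSpace X] (hX : IsPseudocompact X)
    {K : Set (StoneCech X)} (hK : IsCompact K) (hG : IsGδ K)
    (hKX : K ⊆ (range (stoneCechUnit : X → StoneCech X))ᶜ) : K = ∅ := by
  obtain ⟨f, hf, -, -, hf01⟩ :=
    exists_continuous_one_zero_of_isCompact_of_isGδ hK hG isClosed_empty (disjoint_empty K)
  have hpos : ∀ x : X, 0 < 1 - f (stoneCechUnit x) := by
    intro x
    refine sub_pos.2 (lt_of_le_of_ne (hf01 _).2 fun h => ?_)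
    exact hKX (hf ▸ h : stoneCechUnit x ∈ K) ⟨x, rfl⟩
  have hcont : Continuous fun x : X => 1 - f (stoneCechUnit x) :=
    continuous_const.sub (f.continuous.comp continuous_stoneCechUnit)
  -- As `f = 1` exactly on `K`, this reciprocal is continuous on `X`, yet density of `X` makes it
  -- unbounded near any point of `K`.
  obtain ⟨C, hC⟩ := hX (fun x => (1 - f (stoneCechUnit x))⁻¹) (hcont.inv₀ fun x => (hpos x).ne')
  refine eq_empty_of_forall_notMem fun q hq => ?_
  have hq1 : f q = 1 := by rw [hf] at hq; exact hq
  have hopen : IsOpen {y : StoneCech X | 1 - f y < (|C| + 1)⁻¹} :=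
    isOpen_lt (continuous_const.sub f.continuous) continuous_const
  have hC0 : 0 < |C| + 1 := by positivity
  obtain ⟨_, hx, x, rfl⟩ := denseRange_stoneCechUnit.inter_open_nonempty _ hopen
    ⟨q, by simp only [mem_ofPred_eq, hq1, sub_self]; positivity⟩
  have h1 := (lt_inv_comm₀ (hpos x) hC0).1 hx
  have h2 := (le_abs_self _).trans (hC x)
  linarith [le_abs_self C]

theorem innerRegular_dirac {Y : Type*} [TopologicalSpace Y] [MeasurableSpace Y] (y : Y) :
    (Measure.dirac y).InnerRegular := by
  refine ⟨fun U hU r hr => ?_⟩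
  by_cases hy : y ∈ U
  · exact ⟨{y}, singleton_subset_iff.2 hy, isCompact_singleton, by
      rw [Measure.dirac_apply_of_mem (mem_singleton y)]
      rwa [Measure.dirac_apply_of_mem hy] at hr⟩
  · rw [Measure.dirac_apply' y hU, indicator_of_notMem hy] at hr
    exact absurd hr not_lt_zero

/-- The Dirac measure as a Radon probability measure. -/
def diracRadonProb {Y : Type*} [TopologicalSpace Y] [MeasurableSpace Y] [BorelSpace Y] (y : Y) :
    RadonProb Y :=
  ⟨⟨Measure.dirac y, inferInstance⟩, innerRegular_dirac y⟩

theorem IsPseudocompact.mem_radonProbSigma {X : Type*} [TopologicalSpace X]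
    (hX : IsPseudocompact X) (ν : RadonProb (StoneCech X)) : ν ∈ RadonProbSigma X := by
  intro K hK hG hKX
  rw [hX.eq_empty_of_isGδ hK hG hKX, measure_empty]

/-- The indicator of the odd numbers. -/
def parity (n : ℕ) : ℝ := if Even n then 0 else 1

theorem not_tendsto_parity (l : ℝ) : ¬ Tendsto parity atTop (𝓝 l) := by
  intro h
  have h2 : Tendsto (fun n : ℕ => 2 * n) atTop atTop :=
    tendsto_atTop_mono (fun n => by dsimp; omega) tendsto_id
  have e0 : (fun n : ℕ => parity (2 * n)) = fun _ => 0 := by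
    funext n
    simp [parity]
  have e1 : (fun n : ℕ => parity (2 * n + 1)) = fun _ => 1 := by
    funext n
    simp [parity]
  have h0 : Tendsto (fun n : ℕ => parity (2 * n)) atTop (𝓝 l) := h.comp h2
  have h1 : Tendsto (fun n : ℕ => parity (2 * n + 1)) atTop (𝓝 l) :=
    h.comp ((tendsto_add_atTop_nat 1).comp h2)
  rw [e0, tendsto_const_nhds_iff] at h0
  rw [e1, tendsto_const_nhds_iff] at h1
  exact zero_ne_one (h0.trans h1.symm)

/-! ### Measures that are almost uniform on a level of the Cantor tree -/

namespace PsiSpace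

variable {A : Type*} {M : A → Set CantorTree}

variable (M) in
/-- The point of the Stone–Čech compactification given by a sequence of length `n`. -/
def levelPoint (n : ℕ) (s : Fin n → Bool) : StoneCech (PsiSpace M) :=
  stoneCechUnit (ofNode M ⟨n, s⟩)

variable (M) in
/-- A bump function supported by the measures that are close to the uniform measure on the `n`-th
level of the Cantor tree. -/
def levelBump (n : ℕ) (ν : RadonProb (StoneCech (PsiSpace M))) : ℝ :=
  -- The factor 4 makes the bump vanish once the total deviation reaches 1/4.
  max 0 (1 - 4 * ∑ s, |(ν.1 : Measure (StoneCech (PsiSpace M))).real {levelPoint M n s}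
    - (2 ^ n)⁻¹|)

theorem isOpenEmbedding_stoneCechUnit (hM : IsMADFamily M) {p : StoneCech (PsiSpace M)}
    (hp : (range (stoneCechUnit : PsiSpace M → StoneCech (PsiSpace M)))ᶜ = {p}) :
    IsOpenEmbedding (stoneCechUnit : PsiSpace M → StoneCech (PsiSpace M)) := by
  have := t35Space hM
  refine ⟨isEmbedding_stoneCechUnit, ?_⟩
  rw [← isClosed_compl_iff, hp]
  exact isClosed_singleton

variable (M) in
theorem isCompact_biUnion_basicNhd (t : Finset (PsiSpace M)) :
    IsCompact (⋃ x ∈ t, basicNhd M x) :=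
  t.isCompact_biUnion fun x _ => isCompact_basicNhd x

theorem isClopen_image_biUnion_basicNhd (hM : IsMADFamily M) {p : StoneCech (PsiSpace M)}
    (hp : (range (stoneCechUnit : PsiSpace M → StoneCech (PsiSpace M)))ᶜ = {p})
    (t : Finset (PsiSpace M)) :
    IsClopen (stoneCechUnit '' ⋃ x ∈ t, basicNhd M x) := by
  refine ⟨((isCompact_biUnion_basicNhd M t).image continuous_stoneCechUnit).isClosed, ?_⟩
  exact (isOpenEmbedding_stoneCechUnit hM hp).isOpenMap _
    (isOpen_biUnion fun x _ => isOpen_basicNhd x)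

theorem isClopen_singleton_levelPoint (hM : IsMADFamily M) {p : StoneCech (PsiSpace M)}
    (hp : (range (stoneCechUnit : PsiSpace M → StoneCech (PsiSpace M)))ᶜ = {p})
    (n : ℕ) (s : Fin n → Bool) : IsClopen {levelPoint M n s} := by
  convert isClopen_image_biUnion_basicNhd hM hp {ofNode M ⟨n, s⟩}
  simp [levelPoint]

theorem continuous_levelBump (hM : IsMADFamily M) {p : StoneCech (PsiSpace M)}
    (hp : (range (stoneCechUnit : PsiSpace M → StoneCech (PsiSpace M)))ᶜ = {p}) (n : ℕ) :
    Continuous (levelBump M n) := by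
  refine continuous_const.max (continuous_const.sub (continuous_const.mul ?_))
  refine continuous_finsetSum _ fun s _ => Continuous.abs (Continuous.sub ?_ continuous_const)
  exact continuous_radonProb_apply_of_isClopen (isClopen_singleton_levelPoint hM hp n s)

open Classical in
theorem card_level_filter_le (hlev : ∀ α n, (M α ∩ cantorLevel n).encard ≤ 4)
    (t : Finset (PsiSpace M)) (n : ℕ) :
    (Finset.univ.filter fun s : Fin n → Bool =>
      ofNode M ⟨n, s⟩ ∈ ⋃ x ∈ t, basicNhd M x).card ≤ 4 * t.card := by
  have h1 : ∀ x, (Finset.univ.filter fun s : Fin n → Bool =>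
      ofNode M ⟨n, s⟩ ∈ basicNhd M x).card ≤ 4 := by
    intro x
    induction x using rec_node_index with
    | node u =>
      refine (Finset.card_le_one.2 ?_).trans (by norm_num)
      intro s hs r hr
      simp only [Finset.mem_filter, Finset.mem_univ, true_and, basicNhd_ofNode,
        mem_singleton_iff, ofNode_inj] at hs hr
      exact eq_of_heq (Sigma.mk.inj (hs.trans hr.symm)).2
    | index α =>
      have hinj : Function.Injective fun s : Fin n → Bool => (⟨n, s⟩ : CantorTree) :=
        fun a b h => eq_of_heq (Sigma.mk.inj h).2
      have h2 : (((Finset.univ.filter fun s : Fin n → Bool =>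
          ofNode M ⟨n, s⟩ ∈ basicNhd M (ofIndex M α)).image
            fun s => (⟨n, s⟩ : CantorTree) : Finset CantorTree) : Set CantorTree).encard ≤ 4 := by
        refine (Set.encard_le_encard ?_).trans (hlev α n)
        intro u hu
        simp only [Finset.coe_image, Finset.coe_filter, Finset.mem_univ, true_and,
          ofNode_mem_basicNhd_ofIndex] at hu
        obtain ⟨s, hs, rfl⟩ := hu
        exact ⟨hs, rfl⟩
      rw [Set.encard_coe_eq_coe_finsetCard, Finset.card_image_of_injective _ hinj] at h2
      exact_mod_cast h2
  have h2 : (Finset.univ.filter fun s : Fin n → Bool =>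
      ofNode M ⟨n, s⟩ ∈ ⋃ x ∈ t, basicNhd M x) ⊆ t.biUnion fun x =>
        Finset.univ.filter fun s : Fin n → Bool => ofNode M ⟨n, s⟩ ∈ basicNhd M x := by
    intro s hs
    simpa using hs
  exact (Finset.card_le_card h2).trans
    ((Finset.card_biUnion_le_card_mul _ _ 4 fun x _ => h1 x).trans (mul_comm _ _).le)

/-- A measure near the uniform measure on the `n`-th level is not concentrated on few basic
neighbourhoods. -/
theorem two_pow_le_of_levelBump_ne_zero (hM : IsMADFamily M) {p : StoneCech (PsiSpace M)}
    (hp : (range (stoneCechUnit : PsiSpace M → StoneCech (PsiSpace M)))ᶜ = {p})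
    (hlev : ∀ α n, (M α ∩ cantorLevel n).encard ≤ 4) {t : Finset (PsiSpace M)} {n : ℕ}
    {ν : RadonProb (StoneCech (PsiSpace M))}
    (hν : 1 / 2 < (ν.1 : Measure (StoneCech (PsiSpace M))).real
      (stoneCechUnit '' ⋃ x ∈ t, basicNhd M x)) (hn : levelBump M n ν ≠ 0) :
    (2 : ℝ) ^ n ≤ 16 * t.card := by
  classical
  set W := ⋃ x ∈ t, basicNhd M x
  set m := (ν.1 : Measure (StoneCech (PsiSpace M)))
  have hinj := (isOpenEmbedding_stoneCechUnit hM hp).injective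
  have hsum : ∑ s, |m.real {levelPoint M n s} - (2 ^ n)⁻¹| < 1 / 4 := by
    by_contra! h
    exact hn (max_eq_left (by linarith))
  -- The level nodes outside `W` carry mass at least `|T|/2^n - 1/4`, and `W` more than 1/2, so
  -- `|T|/2^n < 3/4`. Since `|T| ≥ 2^n - 4|t|`, the bound follows.
  let T : Finset (Fin n → Bool) := Finset.univ.filter fun s => ofNode M ⟨n, s⟩ ∉ W
  have hcard : (2 : ℝ) ^ n ≤ T.card + 4 * t.card := by
    have h1 := Finset.card_filter_add_card_filter_not (s := Finset.univ)
      fun s : Fin n → Bool => ofNode M ⟨n, s⟩ ∈ W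
    have h2 : (Finset.univ : Finset (Fin n → Bool)).card = 2 ^ n := by simp
    have h3 := card_level_filter_le hlev t n
    have h4 : 2 ^ n ≤ T.card + 4 * t.card := by rw [← h2, ← h1]; simp only [T, W]; omega
    exact_mod_cast h4
  have hT : T.card * ((2 : ℝ) ^ n)⁻¹ - 1 / 4 ≤ ∑ s ∈ T, m.real {levelPoint M n s} := by
    have h1 : ∑ s ∈ T, |m.real {levelPoint M n s} - (2 ^ n)⁻¹| ≤ 1 / 4 :=
      (Finset.sum_le_sum_of_subset_of_nonneg (Finset.subset_univ T)
        fun _ _ _ => abs_nonneg _).trans hsum.le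
    have h2 : ∑ s ∈ T, ((2 ^ n)⁻¹ - m.real {levelPoint M n s}) ≤
        ∑ s ∈ T, |m.real {levelPoint M n s} - (2 ^ n)⁻¹| :=
      Finset.sum_le_sum fun s _ => by rw [abs_sub_comm]; exact le_abs_self _
    rw [Finset.sum_sub_distrib, Finset.sum_const, nsmul_eq_mul] at h2
    linarith
  have hle : m.real (stoneCechUnit '' W) + ∑ s ∈ T, m.real {levelPoint M n s} ≤ 1 := by
    have hlp : Function.Injective (levelPoint M n) := fun a b h =>
      eq_of_heq (Sigma.mk.inj (ofNode_injective (hinj h))).2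
    have h1 : ∑ s ∈ T, m.real {levelPoint M n s} = m.real (T.image (levelPoint M n)) := by
      rw [← sum_measureReal_singleton, Finset.sum_image hlp.injOn]
    rw [h1, ← measureReal_union _ (Finset.measurableSet _)]
    · exact measureReal_le_one
    · rw [Set.disjoint_left]
      rintro _ ⟨x, hx, rfl⟩ hxT
      simp only [Finset.coe_image, mem_image, Finset.mem_coe] at hxT
      obtain ⟨s, hs, hsx⟩ := hxT
      have := hinj hsx
      exact (Finset.mem_filter.1 hs).2 (this ▸ hx)
  have h2n : (0 : ℝ) < 2 ^ n := by positivity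
  have h3 : (T.card : ℝ) * (2 ^ n)⁻¹ < 3 / 4 := by linarith
  rw [← div_eq_mul_inv, div_lt_iff₀ h2n] at h3
  linarith

/-- Membership in `P_τ` gives `p` mass zero; inner regularity then finds a compact part of `X` of
mass above 1/2, and finitely many basic neighbourhoods cover it. -/
theorem exists_finset_half_lt (hM : IsMADFamily M) {p : StoneCech (PsiSpace M)}
    (hp : (range (stoneCechUnit : PsiSpace M → StoneCech (PsiSpace M)))ᶜ = {p})
    {ν : RadonProb (StoneCech (PsiSpace M))} (hν : ν ∈ RadonProbTau (PsiSpace M)) :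
    ∃ t : Finset (PsiSpace M), 1 / 2 < (ν.1 : Measure (StoneCech (PsiSpace M))).real
      (stoneCechUnit '' ⋃ x ∈ t, basicNhd M x) := by
  set m := (ν.1 : Measure (StoneCech (PsiSpace M)))
  have hemb := isOpenEmbedding_stoneCechUnit hM hp
  have hR : m (range stoneCechUnit) = 1 := by
    rw [← prob_compl_eq_zero_iff hemb.isOpen_range.measurableSet]
    exact hν _ (hp ▸ isCompact_singleton) subset_rfl
  obtain ⟨K, hKR, hK, hKm⟩ := ν.2.innerRegular hemb.isOpen_range.measurableSet (1 / 2)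
    (by change _ < m _; rw [hR]; simp)
  have hK' : IsCompact ((stoneCechUnit : PsiSpace M → _) ⁻¹' K) := by
    rwa [hemb.isEmbedding.isCompact_iff, image_preimage_eq_of_subset hKR]
  obtain ⟨t, ht⟩ := exists_finset_subset_biUnion_basicNhd hK'
  refine ⟨t, ?_⟩
  have h1 : 1 / 2 < m (stoneCechUnit '' ⋃ x ∈ t, basicNhd M x) := by
    refine hKm.trans_le (measure_mono ?_)
    rw [← image_preimage_eq_of_subset hKR]
    exact image_mono ht
  rw [Measure.real, ← ENNReal.ofReal_lt_iff_lt_toReal (by norm_num) (measure_ne_top _ _)]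
  simpa [ENNReal.ofReal_div_of_pos] using h1

theorem locallyFinite_support_levelBump (hM : IsMADFamily M) {p : StoneCech (PsiSpace M)}
    (hp : (range (stoneCechUnit : PsiSpace M → StoneCech (PsiSpace M)))ᶜ = {p})
    (hlev : ∀ α n, (M α ∩ cantorLevel n).encard ≤ 4) :
    LocallyFinite fun n => Function.support
      fun ν : RadonProbTau (PsiSpace M) => levelBump M n ν.1 := by
  intro ν
  obtain ⟨t, ht⟩ := exists_finset_half_lt hM hp ν.2
  have hcont := (continuous_radonProb_apply_of_isClopen
    (isClopen_image_biUnion_basicNhd hM hp t)).comp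
      (continuous_subtype_val (p := (· ∈ RadonProbTau (PsiSpace M))))
  refine ⟨_, (isOpen_lt continuous_const hcont).mem_nhds ht, ?_⟩
  refine (Set.finite_Iic (16 * t.card)).subset ?_
  rintro n ⟨ν', hn, hν'⟩
  have h1 := two_pow_le_of_levelBump_ne_zero hM hp hlev hν' hn
  have h2 : 2 ^ n ≤ 16 * t.card := by exact_mod_cast h1
  exact n.lt_two_pow_self.le.trans h2

variable (M) in
/-- The combination of the bump functions with coefficients `c n`, on `P_τ`. -/
def bumpSum (c : ℕ → ℝ) (ν : RadonProbTau (PsiSpace M)) : ℝ :=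
  ∑ᶠ n, c n * levelBump M n ν.1

theorem continuous_bumpSum (hM : IsMADFamily M) {p : StoneCech (PsiSpace M)}
    (hp : (range (stoneCechUnit : PsiSpace M → StoneCech (PsiSpace M)))ᶜ = {p})
    (hlev : ∀ α n, (M α ∩ cantorLevel n).encard ≤ 4) (c : ℕ → ℝ) : Continuous (bumpSum M c) := by
  refine continuous_finsum (fun n => continuous_const.mul
    ((continuous_levelBump hM hp n).comp continuous_subtype_val)) ?_
  refine (locallyFinite_support_levelBump hM hp hlev).subset fun n ν hν => ?_
  exact right_ne_zero_of_mul hν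

theorem measurable_node (n : ℕ) : Measurable fun s : Fin n → Bool => ofNode M ⟨n, s⟩ :=
  measurable_of_finite _

variable (M) in
/-- The uniform measure on the `n`-th level of the Cantor tree. -/
def levelUniform (n : ℕ) : RadonProb (PsiSpace M) :=
  ⟨⟨(PMF.uniformOfFintype (Fin n → Bool)).toMeasure.map fun s => ofNode M ⟨n, s⟩,
    Measure.isProbabilityMeasure_map (measurable_node n).aemeasurable⟩, by
    have : (PMF.uniformOfFintype (Fin n → Bool)).toMeasure.InnerRegular :=
      ⟨fun U _ r hr => ⟨U, subset_rfl, U.toFinite.isCompact, hr⟩⟩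
    exact Measure.InnerRegular.map_of_continuous
      (continuous_of_discreteTopology (f := fun s : Fin n → Bool => ofNode M ⟨n, s⟩))⟩

theorem radonToStoneCech_levelUniform (n : ℕ) :
    ((radonToStoneCech (PsiSpace M) (levelUniform M n)).1 : Measure (StoneCech (PsiSpace M))) =
      (PMF.uniformOfFintype (Fin n → Bool)).toMeasure.map (levelPoint M n) :=
  Measure.map_map continuous_stoneCechUnit.measurable (measurable_node n)

theorem levelBump_levelUniform (hM : IsMADFamily M) {p : StoneCech (PsiSpace M)}
    (hp : (range (stoneCechUnit : PsiSpace M → StoneCech (PsiSpace M)))ᶜ = {p}) (m n : ℕ) :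
    levelBump M m (radonToStoneCech (PsiSpace M) (levelUniform M n)) = if m = n then 1 else 0 := by
  have hinj : ∀ {m n s r}, levelPoint M m s = levelPoint M n r →
      (⟨m, s⟩ : CantorTree) = ⟨n, r⟩ := fun h =>
    ofNode_injective ((isOpenEmbedding_stoneCechUnit hM hp).injective h)
  have hpre : ∀ s : Fin m → Bool,
      ((radonToStoneCech (PsiSpace M) (levelUniform M n)).1 : Measure (StoneCech (PsiSpace M))).real
        {levelPoint M m s} = if m = n then ((2 : ℝ) ^ n)⁻¹ else 0 := by
    intro s
    rw [radonToStoneCech_levelUniform, map_measureReal_apply (measurable_of_finite _)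
      (measurableSet_singleton _)]
    split_ifs with h
    · subst h
      have : levelPoint M m ⁻¹' {levelPoint M m s} = {s} := by
        ext r
        exact ⟨fun h => eq_of_heq (Sigma.mk.inj (hinj h)).2, fun h => by rw [h]; rfl⟩
      rw [this, Measure.real, PMF.toMeasure_apply_singleton _ _ (measurableSet_singleton s)]
      simp
    · have : levelPoint M n ⁻¹' {levelPoint M m s} = ∅ := by
        refine eq_empty_of_forall_notMem fun r hr => h ?_
        exact (congrArg Sigma.fst (hinj hr)).symm
      rw [this, measureReal_empty]
  simp only [levelBump, hpre]
  split_ifs with h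
  · simp [h]
  -- All masses on level `m` vanish, so the deviation is `2^m * 2^(-m) = 1` and `1 - 4 < 0`.
  · simp

theorem bumpSum_levelUniform (hM : IsMADFamily M) {p : StoneCech (PsiSpace M)}
    (hp : (range (stoneCechUnit : PsiSpace M → StoneCech (PsiSpace M)))ᶜ = {p}) (c : ℕ → ℝ)
    (n : ℕ) : bumpSum M c (radonToTau (PsiSpace M) (levelUniform M n)) = c n := by
  have h : ∀ m, levelBump M m (radonToTau (PsiSpace M) (levelUniform M n)).1 =
      if m = n then 1 else 0 := fun m => levelBump_levelUniform hM hp m n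
  rw [bumpSum, finsum_eq_single _ n fun m hm => by rw [h, if_neg hm, mul_zero], h, if_pos rfl,
    mul_one]

/-- The uniform measures on the levels converge to the Dirac measure at the remainder. -/
theorem tendsto_levelUniform (hM : IsMADFamily M) {p : StoneCech (PsiSpace M)}
    (hp : (range (stoneCechUnit : PsiSpace M → StoneCech (PsiSpace M)))ᶜ = {p})
    (hlev : ∀ α n, (M α ∩ cantorLevel n).encard ≤ 4) :
    Tendsto (fun n => radonToStoneCech (PsiSpace M) (levelUniform M n)) atTop
      (𝓝 (diracRadonProb p)) := by
  classical
  rw [tendsto_subtype_rng, ProbabilityMeasure.tendsto_iff_forall_integral_tendsto]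
  intro g
  have hint : ∀ n, ∫ ω, g ω ∂((radonToStoneCech (PsiSpace M) (levelUniform M n)).1 :
      Measure (StoneCech (PsiSpace M))) = ((2 : ℝ) ^ n)⁻¹ * ∑ s, g (levelPoint M n s) := by
    intro n
    rw [radonToStoneCech_levelUniform, integral_map (measurable_of_finite _).aemeasurable
      g.continuous.aestronglyMeasurable, PMF.integral_eq_sum, Finset.mul_sum]
    simp
  have hdirac : ∫ ω, g ω ∂((diracRadonProb p).1 : Measure (StoneCech (PsiSpace M))) = g p :=
    integral_dirac _ _
  rw [hdirac]
  simp only [hint]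
  rw [Metric.tendsto_atTop]
  intro ε hε
  have hemb := isOpenEmbedding_stoneCechUnit hM hp
  have hK : IsCompact {q | ε / 2 ≤ |g q - g p|} :=
    (isClosed_le continuous_const (g.continuous.sub continuous_const).abs).isCompact
  have hKR : {q | ε / 2 ≤ |g q - g p|} ⊆ range (stoneCechUnit : PsiSpace M → _) := by
    intro q hq
    by_contra hqr
    obtain rfl : q = p := by
      have : q ∈ (range (stoneCechUnit : PsiSpace M → _))ᶜ := hqr
      rwa [hp] at this
    simp only [mem_ofPred_eq, sub_self, abs_zero] at hq
    linarith
  obtain ⟨t, ht⟩ := exists_finset_subset_biUnion_basicNhd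
    (show IsCompact ((stoneCechUnit : PsiSpace M → _) ⁻¹' {q | ε / 2 ≤ |g q - g p|}) by
      rwa [hemb.isEmbedding.isCompact_iff, image_preimage_eq_of_subset hKR])
  -- At most `4|t|` nodes of a level lie where `g` is far from `g p`, each contributing at most
  -- `2‖g‖`.
  let B : ℝ := 4 * t.card * (2 * ‖g‖)
  have hbound : ∀ n, |((2 : ℝ) ^ n)⁻¹ * ∑ s, g (levelPoint M n s) - g p| ≤
      ε / 2 + B * ((1 : ℝ) / 2) ^ n := by
    intro n
    have h2n : (0 : ℝ) < 2 ^ n := by positivity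
    have hterm : ∀ s, |g (levelPoint M n s) - g p| ≤ ε / 2 +
        if ofNode M ⟨n, s⟩ ∈ ⋃ x ∈ t, basicNhd M x then 2 * ‖g‖ else 0 := by
      intro s
      split_ifs with h
      · have := g.dist_le_two_norm (levelPoint M n s) p
        rw [Real.dist_eq] at this
        linarith
      · have : ¬ ε / 2 ≤ |g (levelPoint M n s) - g p| := fun h' => h (ht h')
        linarith
    have hsum : |∑ s, (g (levelPoint M n s) - g p)| ≤ 2 ^ n * (ε / 2) + B := by
      refine (Finset.abs_sum_le_sum_abs _ _).trans ((Finset.sum_le_sum fun s _ => hterm s).trans ?_)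
      rw [Finset.sum_add_distrib, ← Finset.sum_filter, Finset.sum_const, Finset.sum_const,
        nsmul_eq_mul, nsmul_eq_mul]
      have h1 : ((Finset.univ : Finset (Fin n → Bool)).card : ℝ) = 2 ^ n := by simp
      have h2 : (((Finset.univ.filter fun s : Fin n → Bool =>
          ofNode M ⟨n, s⟩ ∈ ⋃ x ∈ t, basicNhd M x).card : ℕ) : ℝ) ≤ 4 * t.card := by
        exact_mod_cast card_level_filter_le hlev t n
      rw [h1]
      exact add_le_add_right (mul_le_mul_of_nonneg_right h2 (by positivity)) _
    have heq : ((2 : ℝ) ^ n)⁻¹ * ∑ s, g (levelPoint M n s) - g p =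
        ((2 : ℝ) ^ n)⁻¹ * ∑ s, (g (levelPoint M n s) - g p) := by
      rw [Finset.sum_sub_distrib, Finset.sum_const, nsmul_eq_mul]
      simp [mul_sub]
    rw [heq, abs_mul, abs_of_pos (inv_pos.2 h2n)]
    calc _ ≤ ((2 : ℝ) ^ n)⁻¹ * (2 ^ n * (ε / 2) + B) := by gcongr
      _ = _ := by rw [mul_add, inv_mul_cancel_left₀ h2n.ne', one_div, inv_pow, mul_comm B]
  have hlim : Tendsto (fun n => ε / 2 + B * ((1 : ℝ) / 2) ^ n) atTop (𝓝 (ε / 2 + B * 0)) :=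
    tendsto_const_nhds.add ((tendsto_pow_atTop_nhds_zero_of_lt_one (by norm_num)
      (by norm_num)).const_mul B)
  obtain ⟨N, hN⟩ := eventually_atTop.1 (hlim.eventually_lt_const
    (show ε / 2 + B * 0 < ε by linarith))
  exact ⟨N, fun n hn => (hbound n).trans_lt (hN n hn)⟩

theorem not_isPseudocompact_radonProb (hM : IsMADFamily M) {p : StoneCech (PsiSpace M)}
    (hp : (range (stoneCechUnit : PsiSpace M → StoneCech (PsiSpace M)))ᶜ = {p})
    (hlev : ∀ α n, (M α ∩ cantorLevel n).encard ≤ 4) :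
    ¬ IsPseudocompact (RadonProb (PsiSpace M)) := by
  intro h
  obtain ⟨C, hC⟩ := h _ ((continuous_bumpSum hM hp hlev fun n => n).comp
    (continuous_radonToTau (PsiSpace M)))
  obtain ⟨n, hn⟩ := exists_nat_gt C
  have := (le_abs_self _).trans (hC (levelUniform M n))
  rw [Function.comp_apply, bumpSum_levelUniform hM hp] at this
  linarith

theorem not_isCStarEmbedded_radonToStoneCech (hM : IsMADFamily M) {p : StoneCech (PsiSpace M)}
    (hp : (range (stoneCechUnit : PsiSpace M → StoneCech (PsiSpace M)))ᶜ = {p})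
    (hlev : ∀ α n, (M α ∩ cantorLevel n).encard ≤ 4) :
    ¬ IsCStarEmbedded (radonToStoneCech (PsiSpace M)) := by
  intro h
  obtain ⟨g, hg, hgf⟩ := h
    -- Clipping to `[0, 1]` ensures boundedness and keeps the parity values at the level measures.
    (fun μ => max 0 (min 1 (bumpSum M parity (radonToTau (PsiSpace M) μ))))
    (continuous_const.max (continuous_const.min ((continuous_bumpSum hM hp hlev parity).comp
      (continuous_radonToTau (PsiSpace M)))))
    ⟨1, fun μ => by
      rw [abs_of_nonneg (le_max_left _ _)]
      exact max_le zero_le_one (min_le_left _ _)⟩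
  refine not_tendsto_parity _ (((hg.tendsto _).comp (tendsto_levelUniform hM hp hlev)).congr
    fun n => ?_)
  rw [Function.comp_apply, hgf, bumpSum_levelUniform hM hp]
  unfold parity
  split_ifs <;> norm_num

theorem not_isCEmbedded_tauToSigma (hM : IsMADFamily M) {p : StoneCech (PsiSpace M)}
    (hp : (range (stoneCechUnit : PsiSpace M → StoneCech (PsiSpace M)))ᶜ = {p})
    (hlev : ∀ α n, (M α ∩ cantorLevel n).encard ≤ 4) (hps : IsPseudocompact (PsiSpace M)) :
    ¬ IsCEmbedded (tauToSigma (PsiSpace M)) := by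
  intro h
  obtain ⟨g, hg, hgf⟩ := h _ (continuous_bumpSum hM hp hlev parity)
  have hlim : Tendsto (fun n => tauToSigma (PsiSpace M)
      (radonToTau (PsiSpace M) (levelUniform M n))) atTop
      (𝓝 ⟨diracRadonProb p, hps.mem_radonProbSigma _⟩) :=
    tendsto_subtype_rng.2 (tendsto_levelUniform hM hp hlev)
  refine not_tendsto_parity _ (((hg.tendsto _).comp hlim).congr fun n => ?_)
  rw [Function.comp_apply, hgf, bumpSum_levelUniform hM hp]

end PsiSpace

/-! ### Assembly of the main theorem -/

theorem IsPseudocompact.of_surjective {X Y : Type*} [TopologicalSpace X] [TopologicalSpace Y]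
    (hX : IsPseudocompact X) {e : X → Y} (he : Continuous e) (hs : Function.Surjective e) :
    IsPseudocompact Y := by
  intro f hf
  obtain ⟨C, hC⟩ := hX _ (hf.comp he)
  exact ⟨C, fun y => by obtain ⟨x, rfl⟩ := hs y; exact hC x⟩

theorem Setoid.IsPartition.infinite {α : Type*} [Infinite α] {Q : Set (Set α)}
    (hQ : Setoid.IsPartition Q) (hfin : ∀ P ∈ Q, P.Finite) : Infinite Q := by
  rw [Set.infinite_coe_iff]
  intro h
  refine Set.infinite_univ (α := α) ?_
  rw [← hQ.sUnion_eq_univ]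
  exact h.sUnion hfin

end

theorem mainTheorem4 :
    ∃ (D : (ℕ → Bool) → Set CantorTree) (Q : Set (Set (ℕ → Bool))),
      (∀ x, cantorBranch x ⊆ D x) ∧
      IsMADFamily D ∧
      (∀ x n, (D x ∩ cantorLevel n).encard ≤ 2) ∧
      Setoid.IsPartition Q ∧
      (∀ P ∈ Q, P.encard = 2) ∧
      IsMrowkaSpace (MergedPsiSpace D Q) ∧
      LocallyCompactSpace (MergedPsiSpace D Q) ∧
      (∀ ι : Type u, IsPseudocompact (ι → MergedPsiSpace D Q)) ∧
      ¬ IsPseudocompact (RadonProb (MergedPsiSpace D Q)) ∧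
      ¬ IsCStarEmbedded (radonToStoneCech (MergedPsiSpace D Q)) ∧
      ¬ StoneCechCommutesWithRadonProb (MergedPsiSpace D Q) ∧
      ¬ IsCEmbedded (tauToSigma (MergedPsiSpace D Q)) ∧
      ¬ IsHewittRealcompactification (tauToSigma (MergedPsiSpace D Q)) := by
  obtain ⟨D, hbranch, hD, hthin⟩ := exists_thin_madFamily
  obtain ⟨Q, hQ, hQ2, hsplit⟩ := exists_pairing hbranch hD
  have hQfin : ∀ P ∈ Q, P.Finite := fun P hP => Set.finite_of_encard_eq_coe (hQ2 P hP)
  have hM : IsMADFamily fun P : Q => ⋃ x ∈ P.1, D x := hD.merge hQ hQfin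
  have := hQ.infinite hQfin
  have hlev : ∀ (P : Q) n, ((⋃ x ∈ P.1, D x) ∩ cantorLevel n).encard ≤ 4 := by
    intro P n
    obtain ⟨x, y, -, hxy⟩ := Set.encard_eq_two.1 (hQ2 P P.2)
    rw [hxy, biUnion_pair, union_inter_distrib_right]
    refine (Set.encard_union_le _ _).trans ((add_le_add (hthin x n) (hthin y n)).trans ?_)
    norm_num
  have hsplit' : ∀ f : MergedPsiSpace D Q → ℝ, Continuous f → ∀ a b, a < b →
      {P | f (PsiSpace.ofIndex _ P) ≤ a}.Finite ∨ {P | b ≤ f (PsiSpace.ofIndex _ P)}.Finite := by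
    intro f hf a b hab
    have hex : ∀ x, ∃ P : Q, x ∈ P.1 := fun x =>
      let ⟨P, ⟨hP, hx⟩, _⟩ := hQ.2 x
      ⟨⟨P, hP⟩, hx⟩
    -- `c x` is the pair containing `x`. Since `D x` lies in the merged set of `c x`, the limit of
    -- `f` along `D x` is its value at that index, hence constant on pairs.
    choose c hc using hex
    have hcP : ∀ (P : Q) x, x ∈ P.1 → c x = P := fun P x hx => Subtype.ext
      ((hQ.2 x).unique ⟨(c x).2, hc x⟩ ⟨P.2, hx⟩)
    have hcs : Function.Surjective c := fun P =>
      let ⟨x, hx⟩ := Setoid.nonempty_of_mem_partition hQ P.2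
      ⟨x, hcP P x hx⟩
    refine (hsplit (fun u => f (PsiSpace.ofNode _ u)) (fun x => f (PsiSpace.ofIndex _ (c x)))
      (fun x => ?_) (fun P hP x hx y hy => ?_) a b hab).imp (fun h => ?_) (fun h => ?_)
    · refine ((hf.tendsto _).comp (PsiSpace.tendsto_ofNode (c x))).mono_left ?_
      exact inf_le_inf_left _ (Filter.principal_mono.2 (subset_biUnion_of_mem (u := D) (hc x)))
    · rw [hcP ⟨P, hP⟩ x hx, hcP ⟨P, hP⟩ y hy]
    · exact Set.Finite.of_preimage h hcs
    · exact Set.Finite.of_preimage h hcs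
  obtain ⟨p, hp⟩ := PsiSpace.exists_remainder_eq_singleton hM hsplit'
  have hpow : ∀ ι : Type u, IsPseudocompact (ι → MergedPsiSpace D Q) :=
    PsiSpace.isPseudocompact_pi hM
  have hps : IsPseudocompact (MergedPsiSpace D Q) :=
    (hpow PUnit).of_surjective (continuous_apply PUnit.unit) fun x => ⟨fun _ => x, rfl⟩
  have hstar := PsiSpace.not_isCStarEmbedded_radonToStoneCech hM hp hlev
  have htau := PsiSpace.not_isCEmbedded_tauToSigma hM hp hlev hps
  exact ⟨D, Q, hbranch, hD, hthin, hQ, hQ2, PsiSpace.isMrowkaSpace hM hsplit',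
    PsiSpace.locallyCompactSpace hM, hpow,
    PsiSpace.not_isPseudocompact_radonProb hM hp hlev, hstar,
    fun h => hstar (isCStarEmbedded_of_stoneCechCommutes _ h), htau, fun h => htau h.2.2.1⟩
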